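/- A signature $\mathcal F$ is a finite set of symbols, each with an arity, that contains at least one symbol of arity $0$. Terms over $\mathcal F$ and a countably infinite set $\mathcal X$ of variables are built as usual. A tree is a ground term, i.e. a term without variables; a context is a term with exactly one occurrence of a variable (and no other variable occurrence). A bottom-up deterministic finite tree automaton (DFTA) $\mathcal A=(\mathcal F,Q,Q_{\mathrm{acc}},\delta)$ has a finite state set $Q$, accepting states $Q_{\mathrm{acc}}\subseteq Q$ and a transition function that assigns a state $\delta(q_1,\dots,q_k,f)\in Q$ to each $f\in\mathcal F$ of arity $k$ and all $q_1,\dots,q_k\in Q$. It is extended to trees by $\widehat\delta(f(t_1,\dots,t_k))=\delta(\widehat\delta(t_1),\dots,\widehat\delta(t_k),f)$, and $L(\mathcal A)$ is the set of trees $t$ with $\widehat\delta(t)\in Q_{\mathrm{acc}}$. A rewrite rule $l\to r$ is consistent with a tree language $L$ if for all trees $s,t$ such that $s$ can be rewritten to $t$ in finitely many (possibly zero) steps of the term rewriting system $\{l\to r\}$, we have $s\in L\iff t\in L$. Lemma. The following problem is decidable in polynomial time. Given a DFTA $\mathcal A$ (not necessarily minimal; the signature is part of the input, and the input lists the symbols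 with their arities, the states with their acceptance status, and the full transition table, with numbers in binary), decide whether there is a rule $l\to r$ such that $l$ is a context, $r$ is a ground term, and $l\to r$ is consistent with $L(\mathcal A)$. That is, there are a Turing machine and a polynomial $p$ such that on every such input, encoded as a word of length $N$, the machine halts after at most $p(N)$ steps with the correct answer. -/

import Mathlib

namespace TreeAutomata

/-- A signature (ranked alphabet): symbols with arities, among them at least one constant. -/
structure Signature where
  Sym : Type
  arity : Sym → ℕ
  exists_const : ∃ c : Sym, arity c = 0

/-- Terms over the signature `F` and the set of variables `X`. -/
inductive Term (F : Signature) (X : Type) : Type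
  | var (x : X) : Term F X
  | app (f : F.Sym) (ts : Fin (F.arity f) → Term F X) : Term F X

/-- Trees over `F`, that is, ground terms: terms over the empty set of variables. -/
abbrev Tree (F : Signature) : Type := Term F Empty

namespace Term

variable {F : Signature} {X Y : Type}

/-- The extension of an assignment of terms to variables to all terms. -/
def subst (σ : X → Term F Y) : Term F X → Term F Y
  | var x => σ x
  | app f ts => app f (fun i => (ts i).subst σ)

/-- The number of occurrences of variables in a term. -/
def numVarOcc : Term F X → ℕ
  | var _ => 1
  | app _ ts => ∑ i, (ts i).numVarOcc

/-- A context: a term with exactly one occurrence of a variable (and no other variables).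
The term that consists of a single variable is a context. -/
def IsContext (t : Term F X) : Prop := t.numVarOcc = 1

/-- A ground term, regarded as a term over any set of variables. -/
def ofTree (t : Tree F) : Term F X := t.subst Empty.elim

end Term

/-- A term rewriting system: a finite set of rules `(l, r)`. -/
abbrev TRS (F : Signature) (X : Type) : Type := Finset (Term F X × Term F X)

/-- The single-step rewrite relation. Substitutions have finite domain. -/
inductive Step {F : Signature} {X : Type} (R : TRS F X) : Term F X → Term F X → Prop
  | rule {l r : Term F X} (hlr : (l, r) ∈ R) (σ : X → Term F X)
      (hσ : {x : X | σ x ≠ Term.var x}.Finite) : Step R (l.subst σ) (r.subst σ)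
  | congr (f : F.Sym) (ts : Fin (F.arity f) → Term F X) (i : Fin (F.arity f)) {t : Term F X}
      (h : Step R (ts i) t) : Step R (Term.app f ts) (Term.app f (Function.update ts i t))

/-- The rewriting relation: the reflexive and transitive closure of the single-step relation. -/
def Rewrites {F : Signature} {X : Type} (R : TRS F X) : Term F X → Term F X → Prop :=
  Relation.ReflTransGen (Step R)

/-- `R` is (fully) consistent with the tree language `L`. -/
def Consistent {F : Signature} {X : Type} (R : TRS F X) (L : Set (Tree F)) : Prop :=
  ∀ s t : Tree F, Rewrites R (Term.ofTree s) (Term.ofTree t) → (s ∈ L ↔ t ∈ L)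

/-- A bottom-up deterministic (complete) finite tree automaton over `F` with state set `Q`;
it is only used with finite `Q`. -/
structure DFTA (F : Signature) (Q : Type) where
  acc : Finset Q
  δ : (f : F.Sym) → (Fin (F.arity f) → Q) → Q

namespace DFTA

variable {F : Signature} {Q : Type}

/-- The state that the automaton assigns to a tree. -/
def eval (A : DFTA F Q) : Tree F → Q
  | .app f ts => A.δ f (fun i => A.eval (ts i))

/-- The recognized tree language. -/
def language (A : DFTA F Q) : Set (Tree F) := {t | A.eval t ∈ A.acc}

end DFTA

/-- A finite automaton as the input of an algorithm: a finite signature, with symbols numbered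
`0, …, numSyms - 1`, and a DFTA over it, with states numbered `0, …, numStates - 1`. Every DFTA
over a finite signature is of this form up to the names of its symbols and states. -/
structure DFTAInput where
  numSyms : ℕ
  arity : Fin numSyms → ℕ
  exists_const : ∃ c, arity c = 0
  numStates : ℕ
  aut : DFTA ⟨Fin numSyms, arity, exists_const⟩ (Fin numStates)

/-- The signature of an input. -/
abbrev DFTAInput.sig (A : DFTAInput) : Signature := ⟨Fin A.numSyms, A.arity, A.exists_const⟩

/-- The alphabet in which automata are written down. -/
inductive Letter : Type
  | bit (b : Bool)
  | sym
  | sep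
  | state
  | accept
  | reject
  | trans
  | to
  deriving DecidableEq, Fintype

/-- A natural number, written in binary. -/
def binary (k : ℕ) : List Letter := (Computability.encodeNat k).map Letter.bit

/-- All `k`-tuples of states, in a fixed order. -/
def tuples (n k : ℕ) : List (Fin k → Fin n) :=
  (List.finRange (n ^ k)).map finFunctionFinEquiv.symm

namespace DFTAInput

/-- The symbols with their arities, as blocks `sym f sep arity(f)`. -/
def encodeSyms (A : DFTAInput) : List Letter :=
  (List.finRange A.numSyms).flatMap fun (f : Fin A.numSyms) =>
    [Letter.sym] ++ binary f ++ [Letter.sep] ++ binary (A.arity f)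

/-- The states, as blocks `state q accept` or `state q reject`. -/
def encodeStates (A : DFTAInput) : List Letter :=
  (List.finRange A.numStates).flatMap fun (q : Fin A.numStates) =>
    [Letter.state] ++ binary q ++ [if q ∈ A.aut.acc then Letter.accept else Letter.reject]

/-- The transition table in full, as blocks `trans f sep q₁ … sep qₖ to δ(q₁, …, qₖ, f)`. -/
def encodeTrans (A : DFTAInput) : List Letter :=
  (List.finRange A.numSyms).flatMap fun (f : Fin A.numSyms) =>
    (tuples A.numStates (A.arity f)).flatMap fun (v : Fin (A.arity f) → Fin A.numStates) =>
      [Letter.trans] ++ binary f ++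
        (List.ofFn v).flatMap (fun q => [Letter.sep] ++ binary q) ++
        [Letter.to] ++ binary (A.aut.δ f v)

/-- The word that represents an automaton; its length is the size of the input. -/
def encode (A : DFTAInput) : List Letter := A.encodeSyms ++ A.encodeStates ++ A.encodeTrans

end DFTAInput

open Classical in
/-- The property `P` of the elements of `α`, written down by `enc`, is decidable in polynomial
time: some Turing machine, on every input word `enc a`, halts after a number of steps that is at
most a fixed polynomial in the length of `enc a`, and outputs the truth value of `P a`. -/
def PolyTimeDecidable {α Γ : Type} (enc : α → List Γ) (P : α → Prop) : Prop :=
  Nonempty (Turing.TM2ComputableInPolyTime enc Computability.encodeBool fun a => decide (P a))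

end TreeAutomata

/-!
A context induces a map on the states of the automaton, and a rule from a context `l` to a tree `r`
is consistent with the language if and only if the map of `l` sends all reachable states to states
that are equivalent to the state of `r` (`DFTA.consistent_iff`); two states are equivalent if no map
of a context distinguishes them with respect to acceptance. Since a map of a context sends reachable
states to reachable states, it suffices for the existence of a rule that some map of a context makes
all reachable states equivalent. As equivalence is preserved by the maps of contexts, such maps can
be composed: if for any two reachable states there is a map that makes them equivalent, then there
is one that does so for all reachable states at once (`DFTA.exists_trans_stateEquiv`). So a rule
exists if and only if all pairs of reachable states can be merged
(`DFTA.exists_consistent_rule_iff`). This condition speaks only of reachability in the graph of the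
pairs of states, whose edges `DFTA.Link` are given by two rows of the transition table that agree
but for one argument.

That such a condition can be checked in polynomial time is shown by descriptive complexity. The
relations on the positions of a word that are defined by induction from first-order formulas can be
computed in polynomial time: a formula is evaluated by loops over all positions, a relation is kept
as a bit table, and the stages of an induction become stationary after as many steps as there are
tuples of positions (`StackProgram.polyTimeDecidable_of_indDefs`). The programs for this are
structured programs on stacks, which are translated to Turing machines with several stacks
(`StackProgram.polyTimeDecidable_of_cmd`).

It remains to define the condition by formulas in the word of an automaton. A state is represented
by the positions that its number follows, and equality of numbers is defined by an induction along
the digits. Arities are not bounded, so an edge cannot be described by a formula that names all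
arguments; instead, rows of the transition table are read from left to right by an induction, two of
them simultaneously in the case of edges (`Formula.walkBody`, `Formula.pairBody`). The lemmas
`value_eqBody` to `DFTAInput.value_mergeBody` identify the relations that are defined in this way,
and `DFTAInput.holds_allMerge` is the resulting formula for the condition.
-/

namespace StackProgram

open Function Polynomial Turing TreeAutomata

/-! ### Stack programs and their translation to Turing machines -/

/-- Structured programs that work on stacks named by `K`, all over the alphabet `A`. -/
inductive Cmd (K A : Type) : Type
  | skip : Cmd K A
  | push (k : K) (a : A) : Cmd K A
  | pop (k : K) (f : Option A → Cmd K A) : Cmd K A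
  | seq (c d : Cmd K A) : Cmd K A
  | loop (k : K) (f : A → Cmd K A) : Cmd K A

variable {K A : Type}

/-- `Runs c s t n`: started with the stacks `s`, the program `c` stops with the stacks `t` after at
most `n` steps. `pop k f` removes the top of stack `k` and goes on with `f` of it (with `f none` on
an empty stack); `loop k f` does so until stack `k` is empty. -/
inductive Runs [DecidableEq K] : Cmd K A → (K → List A) → (K → List A) → ℕ → Prop
  | skip (s) : Runs .skip s s 1
  | push (k a s) : Runs (.push k a) s (update s k (a :: s k)) 1
  | pop {k f s t n} (h : Runs (f (s k).head?) (update s k (s k).tail) t n) :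
      Runs (.pop k f) s t (n + 1)
  | seq {c d s t u m n} (h₁ : Runs c s t m) (h₂ : Runs d t u n) : Runs (.seq c d) s u (m + n)
  | loop_nil {k f s} (h : s k = []) : Runs (.loop k f) s s 1
  | loop_cons {k f s a l t u m n} (h : s k = a :: l) (h₁ : Runs (f a) (update s k l) t m)
      (h₂ : Runs (.loop k f) t u n) : Runs (.loop k f) s u (m + n + 1)
  | mono {c s t m n} (h : Runs c s t m) (hmn : m ≤ n) : Runs c s t n

namespace Cmd

/-- The control points of a program. -/
def Lab : Cmd K A → Type
  | skip => Unit
  | push _ _ => Unit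
  | pop _ f => Option (Σ o, (f o).Lab)
  | seq c d => c.Lab ⊕ d.Lab
  | loop _ f => Option (Σ a, (f a).Lab)

theorem finite_lab [Finite A] (c : Cmd K A) : Finite c.Lab := by
  induction c with
  | skip => exact inferInstanceAs (Finite Unit)
  | push => exact inferInstanceAs (Finite Unit)
  | pop k f ih => exact inferInstanceAs (Finite (Option (Σ o, (f o).Lab)))
  | seq c d hc hd => exact inferInstanceAs (Finite (c.Lab ⊕ d.Lab))
  | loop k f ih => exact inferInstanceAs (Finite (Option (Σ a, (f a).Lab)))

/-- The control point at which a program starts. -/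
def entry : (c : Cmd K A) → c.Lab
  | skip => ()
  | push _ _ => ()
  | pop _ _ => none
  | seq c _ => Sum.inl c.entry
  | loop _ _ => none

/-- The stack alphabets of the machine: `A` for the stacks of the program, and `Bool` for one
further stack, which receives the output. -/
abbrev Alph (K A : Type) : Option K → Type
  | none => Bool
  | some _ => A

/-- The machine code at the control points of a program, which are embedded by `emb` into the
labels of the machine; `exit` is the label at which the machine goes on after the program. The
internal state of the machine is the symbol that was popped last. -/
def code {Λ : Type} : (c : Cmd K A) → (c.Lab → Λ) → Λ → c.Lab → TM2.Stmt (Alph K A) Λ (Option A)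
  | skip, _, exit, _ => .goto fun _ => exit
  | push k a, _, exit, _ => .push (some k) (fun _ => a) (.goto fun _ => exit)
  | pop k f, emb, _, none =>
      .pop (some k) (fun _ o => o) (.goto fun o => emb (some ⟨o, (f o).entry⟩))
  | pop _ f, emb, exit, some ⟨o, l⟩ => (f o).code (fun l' => emb (some ⟨o, l'⟩)) exit l
  | seq c d, emb, _, .inl l => c.code (fun l' => emb (.inl l')) (emb (.inr d.entry)) l
  | seq _ d, emb, exit, .inr l => d.code (fun l' => emb (.inr l')) exit l
  | loop k f, emb, exit, none =>
      .pop (some k) (fun _ o => o) (.goto fun o =>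
        match o with
        | none => exit
        | some a => emb (some ⟨a, (f a).entry⟩))
  | loop _ f, emb, _, some ⟨a, l⟩ =>
      (f a).code (fun l' => emb (some ⟨a, l'⟩)) (emb none) l

end Cmd

open Cmd

/-- The stacks of the machine, from those of the program and the output stack. -/
def machineStk (s : K → List A) (o : List Bool) : ∀ k : Option K, List (Alph K A k)
  | none => o
  | some k => s k

variable [DecidableEq K]

theorem update_machineStk (s : K → List A) (o : List Bool) (k : K) (l : List A) :
    update (machineStk s o) (some k) l = machineStk (update s k l) o := by
  funext j
  cases j with
  | none => simp [machineStk]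
  | some j =>
    by_cases h : j = k
    · subst h; simp [machineStk]
    · rw [update_of_ne (by simpa using h)]
      simp [machineStk, h]

theorem flip_bind_step {Λ : Type} {M : Λ → TM2.Stmt (Alph K A) Λ (Option A)} {c : Cmd K A}
    {emb : c.Lab → Λ} {exit : Λ} (hM : ∀ l, M (emb l) = c.code emb exit l) (l v S) :
    flip bind (TM2.step M) (some ⟨some (emb l), v, S⟩) =
      some (TM2.stepAux (c.code emb exit l) v S) := by
  rw [← hM]; rfl

/-- The machine carries out a program within the time bound of `Runs`. -/
theorem Runs.simulation {Λ : Type} {M : Λ → TM2.Stmt (Alph K A) Λ (Option A)} {c : Cmd K A}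
    {s t : K → List A} {n : ℕ} (h : Runs c s t n) (emb : c.Lab → Λ) (exit : Λ)
    (hM : ∀ l, M (emb l) = c.code emb exit l) (v : Option A) (o : List Bool) :
    ∃ m ≤ n, ∃ v', (flip bind (TM2.step M))^[m] (some ⟨some (emb c.entry), v, machineStk s o⟩) =
      some ⟨some exit, v', machineStk t o⟩ := by
  induction h generalizing exit v with
  | skip s =>
    refine ⟨1, le_rfl, v, ?_⟩
    simp [flip, hM, code, TM2.stepAux]
  | push k a s =>
    refine ⟨1, le_rfl, v, ?_⟩
    simp [flip, hM, code, TM2.stepAux, update_machineStk]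
    rfl
  | @pop k f s t n h ih =>
    obtain ⟨m, hm, v', e⟩ := ih (fun l' => emb (some ⟨_, l'⟩)) exit
      (fun l => (hM _).trans (by rw [code])) (s k).head?
    refine ⟨m + 1, by omega, v', ?_⟩
    rw [iterate_succ_apply, ← e, flip_bind_step hM]
    simp [code, entry, TM2.stepAux, update_machineStk, machineStk]
  | @seq c d s t u m n _ _ ih₁ ih₂ =>
    obtain ⟨m₁, hm₁, v₁, e₁⟩ := ih₁ (fun l' => emb (.inl l')) (emb (.inr d.entry))
      (fun l => (hM _).trans (by rw [code])) v
    obtain ⟨m₂, hm₂, v₂, e₂⟩ := ih₂ (fun l' => emb (.inr l')) exit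
      (fun l => (hM _).trans (by rw [code])) v₁
    refine ⟨m₂ + m₁, by omega, v₂, ?_⟩
    rw [iterate_add_apply, entry, e₁, e₂]
  | @loop_nil k f s h =>
    refine ⟨1, le_rfl, none, ?_⟩
    have : update s k [] = s := by rw [← h, update_eq_self]
    rw [iterate_one, flip_bind_step hM]
    simp [code, entry, TM2.stepAux, update_machineStk, machineStk, h, this]
  | @loop_cons k f s a l t u m n h _ _ ih₁ ih₂ =>
    obtain ⟨m₁, hm₁, v₁, e₁⟩ := ih₁ (fun l' => emb (some ⟨a, l'⟩)) (emb none)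
      (fun l => (hM _).trans (by rw [code])) (some a)
    obtain ⟨m₂, hm₂, v₂, e₂⟩ := ih₂ emb exit hM v₁
    refine ⟨m₂ + (m₁ + 1), by omega, v₂, ?_⟩
    rw [iterate_add_apply, iterate_succ_apply, ← e₂, flip_bind_step hM]
    rw [show (entry (.loop k f) : Lab _) = (none : Option _) from rfl, ← e₁]
    simp [code, TM2.stepAux, update_machineStk, machineStk, h]
  | mono h hmn ih =>
    obtain ⟨m, hm, v', e⟩ := ih emb exit hM v
    exact ⟨m, hm.trans hmn, v', e⟩

open Classical in
/-- A stack program that turns the input word into the truth value of `P` in polynomial time gives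
a Turing machine that decides `P` in polynomial time: the machine first runs the program, and then
moves the answer to its output stack. -/
theorem polyTimeDecidable_of_cmd {α Γ : Type} [Fintype Γ] [Fintype K] {enc : α → List Γ}
    {P : α → Prop} (c : Cmd K Γ) (inp out : K) (bit : Bool → Γ) (hbit : Injective bit)
    (p : Polynomial ℕ)
    (h : ∀ a, Runs c (update (fun _ => []) inp (enc a))
      (update (fun _ => []) out [bit (decide (P a))]) (p.eval (enc a).length)) :
    TreeAutomata.PolyTimeDecidable enc P := by
  have := c.finite_lab
  let M : Option c.Lab → TM2.Stmt (Alph K Γ) (Option c.Lab) (Option Γ)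
    | some l => c.code some none l
    -- After the program, the truth value on the stack `out` is moved to the output stack.
    | none => .pop (some out) (fun _ o => o) (.push none (fun o => decide (o = some (bit true)))
        (.load (fun _ => none) .halt))
  let tm : FinTM2 :=
    { K := Option K
      k₀ := some inp
      k₁ := none
      Γ := Alph K Γ
      Λ := Option c.Lab
      main := some c.entry
      ΛFin := Fintype.ofFinite _
      σ := Option Γ
      initialState := none
      Γk₀Fin := inferInstanceAs (Fintype Γ)
      m := M }
  refine ⟨⟨⟨tm, Equiv.refl Γ, Equiv.refl Bool⟩, p + 1, fun a => ?_⟩⟩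
  have key : ∃ m ≤ (p + 1).eval (enc a).length, (flip bind tm.step)^[m]
      (some (initList tm (enc a))) = some (haltList tm [decide (P a)]) := by
    obtain ⟨m, hm, v, e⟩ := (h a).simulation (M := M) some none (fun _ => rfl) none []
    refine ⟨m + 1, by simpa using hm, ?_⟩
    have hi : initList tm (enc a) =
        ⟨some (some c.entry), none, machineStk (update (fun _ => []) inp (enc a)) []⟩ := by
      unfold initList
      congr 1
      funext k
      cases k with
      | none => simp [tm, machineStk]
      | some k =>
        by_cases hk : k = inp
        · subst hk; simp [tm, machineStk]
        · simp [tm, machineStk, hk]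
    have hh : haltList tm [decide (P a)] = ⟨none, none, machineStk (fun _ => []) [decide (P a)]⟩ := by
      unfold haltList
      congr 1
      funext k
      cases k with
      | none => simp [tm, machineStk]
      | some k => simp [tm, machineStk]
    rw [iterate_succ_apply']
    erw [hi, e]
    rw [hh]
    simp only [flip, FinTM2.step, tm]
    change some (TM2.stepAux (M none) _ _) = _
    simp only [M, TM2.stepAux, update_machineStk]
    congr 2
    funext k
    cases k with
    | none => simp [machineStk, hbit.eq_iff]
    | some k => simp [machineStk]
  obtain ⟨hm, e⟩ := key.choose_spec
  exact
    { steps := key.choose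
      evals_in_steps := by
        change _^[_] (some (initList tm ((enc a).map id))) = some (haltList tm [decide (P a)])
        rwa [List.map_id]
      steps_le_m := hm }

/-! ### Stack programs for loops and table lookups -/

theorem Runs.push_eq {k : K} {a : A} {s t : K → List A} (h : t = update s k (a :: s k)) :
    Runs (.push k a) s t 1 := h ▸ .push k a s

theorem Runs.skip_eq {s t : K → List A} (h : t = s) : Runs (.skip : Cmd K A) s t 1 := h ▸ .skip s

/-- Pours the stack `k` onto the stack `t`. -/
def pour (k t : K) : Cmd K A := .loop k fun a => .push t a

theorem runs_pour {k t : K} (h : k ≠ t) (s : K → List A) :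
    Runs (pour k t) s (update (update s k []) t ((s k).reverse ++ s t)) (2 * (s k).length + 1) := by
  generalize hl : s k = l
  induction l generalizing s with
  | nil =>
    have e : update s k [] = s := by rw [← hl, update_eq_self]
    have h₁ : Runs (pour k t) s s 1 := .loop_nil hl
    simpa [e] using h₁
  | cons a l ih =>
    have h₁ := ih (update (update s k l) t (a :: s t)) (by simp [h])
    have h₂ : Runs (.push t a) (update s k l) (update (update s k l) t (a :: s t)) 1 := by
      simpa [h.symm] using Runs.push t a (update s k l)
    have e : update (update (update (update s k l) t (a :: s t)) k []) t
        (l.reverse ++ update (update s k l) t (a :: s t) t) =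
        update (update s k []) t ((a :: l).reverse ++ s t) := by
      rw [update_comm h.symm, update_idem, update_idem]
      simp
    rw [e] at h₁
    exact Runs.mono (.loop_cons hl h₂ h₁) (by simp; omega)

/-- Empties the stack `k`. -/
def clear (k : K) : Cmd K A := .loop k fun _ => .skip

theorem runs_clear (k : K) (s : K → List A) :
    Runs (clear k) s (update s k []) (2 * (s k).length + 1) := by
  generalize hl : s k = l
  induction l generalizing s with
  | nil =>
    rw [← hl, update_eq_self]
    exact Runs.mono (.loop_nil hl) (by simp)
  | cons a l ih =>
    have h₁ := ih (update s k l) (by simp)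
    rw [update_idem] at h₁
    exact Runs.mono (.loop_cons hl (.skip _) h₁) (by simp; omega)

/-- Runs `c` as often as there are symbols on the stack `k`, which is restored at the end; `t` is an
empty stack that holds the symbols already seen. -/
def each (k t : K) (c : Cmd K A) : Cmd K A :=
  .seq (.loop k fun a => .seq (.push t a) c) (pour t k)

/-- The stacks `I i` after `i` rounds are an invariant of `each`. As `c` is run while the symbols are
on their way between the stacks `k` and `t`, it has to work with any contents of these. -/
theorem runs_each {k t : K} (h : k ≠ t) {c : Cmd K A} {n : ℕ} (I : ℕ → K → List A) (l : List A)
    (hk : I 0 k = l) (ht : I 0 t = []) (hk' : I l.length k = l) (ht' : I l.length t = [])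
    (hc : ∀ i < l.length, ∀ l₁ l₂, Runs c (update (update (I i) k l₁) t l₂)
      (update (update (I (i + 1)) k l₁) t l₂) n) :
    Runs (each k t c) (I 0) (I l.length) ((n + 4) * l.length + 2) := by
  have key : ∀ l₁ l₂ i, i + l₁.length = l.length →
      Runs (.loop k fun a => .seq (.push t a) c) (update (update (I i) k l₁) t l₂)
        (update (update (I l.length) k []) t (l₁.reverse ++ l₂)) ((n + 2) * l₁.length + 1) := by
    intro l₁
    induction l₁ with
    | nil =>
      intro l₂ i hi
      simp only [List.length_nil, add_zero] at hi
      subst hi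
      exact Runs.mono (.loop_nil (by simp [h])) (by simp)
    | cons a l₁ ih =>
      intro l₂ i hi
      simp only [List.length_cons] at hi
      have h₁ := ih (a :: l₂) (i + 1) (by omega)
      have h₂ := hc i (by omega) l₁ (a :: l₂)
      have h₃ : Runs (.push t a) (update (update (I i) k l₁) t l₂)
          (update (update (I i) k l₁) t (a :: l₂)) 1 := by
        convert Runs.push t a _ using 1
        simp
      refine Runs.mono (.loop_cons (a := a) (l := l₁) (by simp [h]) (.seq ?_ h₂) (?_)) ?_
        (m := (1 + n) + ((n + 2) * l₁.length + 1) + 1)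
      · convert h₃ using 1
        rw [update_comm h, update_idem]
        rw [update_comm h]
      · convert h₁ using 1
        simp
      · simp only [List.length_cons]; ring_nf; omega
  have e₀ : update (update (I 0) k l) t [] = I 0 := by
    rw [← ht, ← hk, update_eq_self, update_eq_self]
  have h₁ := key l [] 0 (by simp)
  rw [e₀] at h₁
  have h₂ := runs_pour (Ne.symm h) (update (update (I l.length) k []) t (l.reverse ++ []))
  have e₁ : update (update (update (update (I l.length) k []) t (l.reverse ++ [])) t []) k
      ((update (update (I l.length) k []) t (l.reverse ++ []) t).reverse ++
        update (update (I l.length) k []) t (l.reverse ++ []) k) = I l.length := by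
    rw [update_idem, update_comm h, update_idem]
    simp only [List.append_nil, update_self, List.reverse_reverse, ne_eq, h, not_false_eq_true,
      update_of_ne]
    conv_rhs => rw [← update_eq_self t (I l.length), ← update_eq_self k (I l.length)]
    rw [update_comm h.symm]
    simp [h.symm, hk', ht', update_comm h]
  rw [e₁] at h₂
  refine Runs.mono (.seq h₁ h₂) ?_
  simp
  ring_nf
  omega

/-- The stacks after `n` symbols have been moved from the stack `r` to the stack `t`. -/
def shift (r t : K) (n : ℕ) (s : K → List A) : K → List A :=
  update (update s r ((s r).drop n)) t (((s r).take n).reverse ++ s t)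

@[simp] theorem shift_zero (r t : K) (s : K → List A) : shift r t 0 s = s := by
  simp [shift]

theorem shift_shift {r t : K} (h : r ≠ t) (a b : ℕ) (s : K → List A) :
    shift r t b (shift r t a s) = shift r t (a + b) s := by
  unfold shift
  rw [update_comm h, update_idem]
  simp [h, update_comm h, List.take_add]

theorem shift_update {r t k : K} (hr : k ≠ r) (ht : k ≠ t) (n : ℕ) (s : K → List A) (l : List A) :
    shift r t n (update s k l) = update (shift r t n s) k l := by
  unfold shift
  rw [update_comm hr, update_comm ht]
  simp [hr.symm, ht.symm]

theorem shift_apply {r t k : K} (hr : k ≠ r) (ht : k ≠ t) (n : ℕ) (s : K → List A) :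
    shift r t n s k = s k := by
  simp [shift, hr, ht]

/-- Moves the top symbol of the stack `r`, if there is one, to the stack `t`. -/
def moveOne (r t : K) : Cmd K A :=
  .pop r fun o =>
    match o with
    | none => .skip
    | some a => .push t a

theorem runs_moveOne {r t : K} (h : r ≠ t) (s : K → List A) :
    Runs (moveOne r t) s (shift r t 1 s) 2 := by
  refine Runs.pop (n := 1) ?_
  cases hs : s r with
  | nil =>
    have e₀ : update s r [] = s := by rw [← hs, update_eq_self]
    have e : shift r t 1 s = update s r [] := by simp [shift, hs, e₀]
    rw [e]
    exact Runs.skip _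
  | cons a l =>
    have e : shift r t 1 s = update (update s r l) t (a :: update s r l t) := by
      simp [shift, hs, h.symm]
    rw [e]
    exact Runs.push t a _

/-! ### The memory of the machine that evaluates formulas -/

/-- The stacks of the machine that evaluates formulas with variables `V` and relation symbols `M`
in the positions of a word `w`. A position `d`, as the value of the variable `x`, is kept as the
two parts of `w` before and after `d`, on `left x` (reversed) and `right x`. The relations are kept
as bit tables on the stacks `rel m`. Truth values are computed on the stack `bits`. On `new`, the
next value of a relation is built up. For all numbers `j` below the bound `J` on the arities, there
are two stacks `dom b j` that hold `w`; they are used to repeat things `|w|` times. The stacks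
`tmp`, `aux`, and `dtm b j` hold intermediate results. -/
inductive Stk (V M : Type) (J : ℕ) : Type
  | tmp
  | aux
  | new
  | bits
  | left (x : V)
  | right (x : V)
  | rel (m : M)
  | dom (b : Bool) (j : Fin J)
  | dtm (b : Bool) (j : Fin J)
  deriving DecidableEq, Fintype

variable {V M : Type} {J : ℕ} [DecidableEq V] [DecidableEq M]

/-- The same stacks, but with those in the family `dom b`, `dtm b` replaced. -/
def put (b : Bool) (D : Fin J → List A × List A) (s : Stk V M J → List A) : Stk V M J → List A
  | .dom b' j => if b' = b then (D j).1 else s (.dom b' j)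
  | .dtm b' j => if b' = b then (D j).2 else s (.dtm b' j)
  | k => s k

theorem update_put_dom (b : Bool) (D : Fin J → List A × List A) (s : Stk V M J → List A)
    (j : Fin J) (l₁ l₂ : List A) :
    update (update (put b D s) (.dom b j) l₁) (.dtm b j) l₂ = put b (update D j (l₁, l₂)) s := by
  funext k
  cases k with
  | dom b' j' =>
    by_cases hb : b' = b <;> by_cases hj : j' = j <;> simp [put, hb, hj]
  | dtm b' j' =>
    by_cases hb : b' = b <;> by_cases hj : j' = j <;> simp [put, hb, hj]
  | _ => simp [put]

/-- Runs `c` as often as there are `k`-tuples of positions in the word. -/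
def tupleLoop [NeZero J] (b : Bool) : ℕ → Cmd (Stk V M J) A → Cmd (Stk V M J) A
  | 0, c => c
  | j + 1, c => each (.dom b (Fin.ofNat J j)) (.dtm b (Fin.ofNat J j)) (tupleLoop b j c)

/-- The stacks `I i` after `i` rounds are an invariant of `tupleLoop`, apart from the stacks `dom b`
and `dtm b`, on which the rounds are counted. -/
theorem exists_runs_tupleLoop [NeZero J] (b : Bool) (j : ℕ) (hj : j ≤ J) (p : ℕ[X]) :
    ∃ q : ℕ[X], ∀ (c : Cmd (Stk V M J) A) (w : List A) (I : ℕ → Stk V M J → List A)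
      (D : Fin J → List A × List A), (∀ i : Fin J, i.val < j → D i = (w, [])) →
      (∀ i < w.length ^ j, ∀ D, Runs c (put b D (I i)) (put b D (I (i + 1))) (p.eval w.length)) →
      Runs (tupleLoop b j c) (put b D (I 0)) (put b D (I (w.length ^ j))) (q.eval w.length) := by
  induction j with
  | zero =>
    refine ⟨p, fun c w I D _ h => ?_⟩
    simpa [tupleLoop] using h 0 (by simp) D
  | succ j ih =>
    obtain ⟨q, hq⟩ := ih (by omega)
    refine ⟨(q + 4) * X + 2, fun c w I D hD h => ?_⟩
    have hj' : (Fin.ofNat J j).val = j := Nat.mod_eq_of_lt (by omega)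
    have hDj := hD (Fin.ofNat J j) (by omega)
    have := runs_each (k := .dom b (Fin.ofNat J j)) (t := .dtm b (Fin.ofNat J j))
      (c := tupleLoop b j c) (n := q.eval w.length) (by simp)
      (fun i => put b D (I (i * w.length ^ j))) w
      (by simp [put, -Fin.ofNat_eq_cast, hDj]) (by simp [put, -Fin.ofNat_eq_cast, hDj])
      (by simp [put, -Fin.ofNat_eq_cast, hDj]) (by simp [put, -Fin.ofNat_eq_cast, hDj]) ?_
    · simp only [zero_mul] at this
      rw [tupleLoop, pow_succ']
      exact this.mono (by simp)
    · intro i hi l₁ l₂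
      simp only [update_put_dom]
      have := hq c w (fun n => I (i * w.length ^ j + n)) (update D (Fin.ofNat J j) (l₁, l₂)) ?_ ?_
      · simpa [add_mul] using this
      · intro i' hi'
        rw [update_of_ne (by intro e; subst e; omega)]
        exact hD i' (by omega)
      · intro n hn D
        refine h _ ?_ D
        calc i * w.length ^ j + n < i * w.length ^ j + w.length ^ j := by omega
          _ = (i + 1) * w.length ^ j := by ring
          _ ≤ w.length * w.length ^ j := Nat.mul_le_mul_right _ hi
          _ = w.length ^ (j + 1) := by ring

/-- The stacks of the machine, where `ρ` gives the positions of the variables, `R` the tables of the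
relations, `B` the stack of truth values, and `N` the part of a new table that has been built. The
first family of stacks `dom` is used for table lookups, and is full; `D` holds the second one. -/
def conf (w : List A) (D : Fin J → List A × List A) (ρ : V → ℕ) (R : M → List A) (B N : List A) :
    Stk V M J → List A
  | .tmp => []
  | .aux => []
  | .new => N
  | .bits => B
  | .left x => (w.take (ρ x)).reverse
  | .right x => w.drop (ρ x)
  | .rel m => R m
  | .dom b j => if b then (D j).1 else w
  | .dtm b j => if b then (D j).2 else []

section Conf

variable (w : List A) (D : Fin J → List A × List A) (ρ : V → ℕ) (R : M → List A) (B N : List A)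

theorem update_conf_bits (B' : List A) :
    update (conf w D ρ R B N) .bits B' = conf w D ρ R B' N := by
  funext k; cases k <;> simp [conf]

theorem update_conf_new (N' : List A) :
    update (conf w D ρ R B N) .new N' = conf w D ρ R B N' := by
  funext k; cases k <;> simp [conf]

theorem update_conf_rel (m : M) (l : List A) :
    update (conf w D ρ R B N) (.rel m) l = conf w D ρ (update R m l) B N := by
  funext k; cases k <;> simp [conf, update_apply]

theorem update_conf_var (x : V) (d : ℕ) :
    update (update (conf w D ρ R B N) (.left x) (w.take d).reverse) (.right x) (w.drop d) =
      conf w D (update ρ x d) R B N := by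
  funext k
  cases k with
  | left y => by_cases h : y = x <;> simp [conf, h]
  | right y => by_cases h : y = x <;> simp [conf, h]
  | _ => simp [conf]

omit [DecidableEq V] [DecidableEq M] in
theorem put_true_conf (D' : Fin J → List A × List A) :
    put true D' (conf w D ρ R B N) = conf w D' ρ R B N := by
  funext k
  cases k with
  | dom b j => cases b <;> simp [conf, put]
  | dtm b j => cases b <;> simp [conf, put]
  | _ => rfl

end Conf

omit [DecidableEq V] [DecidableEq M] in
theorem put_self {b : Bool} {D : Fin J → List A × List A} {s : Stk V M J → List A}
    (h : ∀ j, D j = (s (.dom b j), s (.dtm b j))) : put b D s = s := by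
  funext k
  cases k with
  | dom b' j => by_cases hb : b' = b <;> simp [put, h, hb]
  | dtm b' j => by_cases hb : b' = b <;> simp [put, h, hb]
  | _ => rfl

theorem put_shift (b : Bool) (D : Fin J → List A × List A) (m : M) (n : ℕ)
    (s : Stk V M J → List A) :
    put b D (shift (.rel m) .aux n s) = shift (.rel m) .aux n (put b D s) := by
  funext k; cases k <;> simp [put, shift, update_apply]

/-- The index of a tuple of positions in the lexicographic order of all tuples of its length. -/
def addr (n : ℕ) : List ℕ → ℕ
  | [] => 0
  | d :: l => d * n ^ l.length + addr n l

/-- Moves the entries of the table of `m` before that at the positions `xs` to the stack `aux`. -/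
def skipTo [NeZero J] (m : M) : List V → Cmd (Stk V M J) A
  | [] => .skip
  | x :: xs => .seq (each (.left x) .tmp (tupleLoop false xs.length (moveOne (.rel m) .aux)))
      (skipTo m xs)

/-- The entries before a given one are skipped without any arithmetic: if `d` is the position of the
first variable, and `k` variables remain, then `d` blocks of `|w| ^ k` entries come before. -/
theorem exists_runs_skipTo [NeZero J] (m : M) (xs : List V) (hxs : xs.length ≤ J) :
    ∃ p : ℕ[X], ∀ (w : List A) (D : Fin J → List A × List A) (ρ : V → ℕ) (R : M → List A)
      (B N : List A) (a : ℕ), (∀ x, ρ x < w.length) →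
      Runs (skipTo m xs) (shift (.rel m) .aux a (conf w D ρ R B N))
        (shift (.rel m) .aux (a + addr w.length (xs.map ρ)) (conf w D ρ R B N))
        (p.eval w.length) := by
  induction xs with
  | nil => exact ⟨1, fun w D ρ R B N a _ => by simpa [addr, skipTo] using Runs.skip _⟩
  | cons x xs ih =>
    obtain ⟨p, hp⟩ := ih (by simp at hxs; omega)
    obtain ⟨q, hq⟩ := exists_runs_tupleLoop (V := V) (M := M) (J := J) (A := A) false xs.length
      (by simp at hxs; omega) 2
    refine ⟨(q + 4) * X + 2 + p, fun w D ρ R B N a hρ => ?_⟩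
    have hlen : (w.take (ρ x)).reverse.length = ρ x := by simp [(hρ x).le]
    have h₁ := runs_each (k := .left x) (t := .tmp)
      (c := tupleLoop false xs.length (moveOne (.rel m) .aux)) (n := q.eval w.length) (by simp)
      (fun i => shift (.rel m) .aux (a + i * w.length ^ xs.length) (conf w D ρ R B N))
      ((w.take (ρ x)).reverse) (by rw [shift_apply (by simp) (by simp)]; rfl)
      (by rw [shift_apply (by simp) (by simp)]; rfl)
      (by rw [shift_apply (by simp) (by simp)]; rfl)
      (by rw [shift_apply (by simp) (by simp)]; rfl) ?_
    · rw [hlen] at h₁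
      have h₂ := hp w D ρ R B N (a + ρ x * w.length ^ xs.length) hρ
      simp only [zero_mul, add_zero] at h₁
      rw [skipTo]
      refine (Runs.seq h₁ (by simpa [addr, add_assoc] using h₂)).mono ?_
      simp only [eval_add, eval_mul, eval_X, eval_ofNat]
      gcongr
      exact (hρ x).le
    · intro i _ l₁ l₂
      set s := shift (.rel m) .aux (a + i * w.length ^ xs.length)
        (update (update (conf w D ρ R B N) (.left x) l₁) .tmp l₂) with hs
      have h₂ := hq (moveOne (.rel m) .aux) w (fun n => shift (.rel m) .aux n s)
        (fun _ => (w, [])) (fun _ _ => rfl) (fun n _ D' => by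
          simp only [put_shift]
          rw [← shift_shift (by simp)]
          simpa using runs_moveOne (by simp) _)
      have hput : put false (fun _ => (w, [])) s = s := by
        rw [hs, put_shift, put_self]
        intro j
        simp [conf]
      simp only [put_shift, hput, shift_zero] at h₂
      rw [hs, shift_shift (by simp), shift_update (by simp) (by simp),
        shift_update (by simp) (by simp), shift_update (by simp) (by simp),
        shift_update (by simp) (by simp)] at h₂
      convert h₂ using 4
      ring

/-! ### Primitive steps of the evaluation of formulas -/

/-- Pushes the entry of the table of `m` at the positions `xs` to the stack `bits`. -/
def lookup [NeZero J] (m : M) (xs : List V) : Cmd (Stk V M J) Letter :=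
  .seq (skipTo m xs) (.seq (.pop (.rel m) fun o =>
      match o with
      | none => .push .bits (.bit false)
      | some a => .seq (.push (.rel m) a) (.push .bits a))
    (pour .aux (.rel m)))

theorem exists_runs_lookup [NeZero J] (m : M) (xs : List V) (hxs : xs.length ≤ J) :
    ∃ p : ℕ[X], ∀ (w : List Letter) (D : Fin J → List Letter × List Letter) (ρ : V → ℕ)
      (R : M → List Letter) (B N : List Letter) (b : Letter), (∀ x, ρ x < w.length) →
      (R m).length ≤ w.length ^ xs.length → (R m)[addr w.length (xs.map ρ)]? = some b →
      Runs (lookup m xs) (conf w D ρ R B N) (conf w D ρ R (b :: B) N) (p.eval w.length) := by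
  obtain ⟨p, hp⟩ := exists_runs_skipTo (J := J) (A := Letter) m xs hxs
  refine ⟨p + (3 + (2 * X ^ xs.length + 1)), fun w D ρ R B N b hρ hlen hb => ?_⟩
  set a := addr w.length (xs.map ρ)
  have h₁ := hp w D ρ R B N 0 hρ
  rw [shift_zero, zero_add] at h₁
  obtain ⟨ha, hb⟩ := List.getElem?_eq_some_iff.1 hb
  have hdrop : (R m).drop a = b :: (R m).drop (a + 1) := by
    rw [List.drop_eq_getElem_cons ha, hb]
  set s := shift (.rel m) .aux a (conf w D ρ R B N) with hs
  have hsrel : s (.rel m) = b :: (R m).drop (a + 1) := by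
    rw [← hdrop]; simp [hs, shift, conf]
  have h₂ : Runs (.pop (.rel m) fun o =>
      match o with
      | none => .push .bits (.bit false)
      | some a => .seq (.push (.rel m) a) (.push .bits a)) s
      (shift (.rel m) .aux a (conf w D ρ R (b :: B) N)) 3 := by
    refine Runs.pop (n := 1 + 1) ?_
    rw [hsrel]
    refine Runs.seq (t := s) ?_ ?_
    · refine Runs.push_eq ?_
      simp only [List.tail_cons, update_self, update_idem]
      rw [← hsrel, update_eq_self]
    · refine Runs.push_eq ?_
      rw [hs, ← shift_update (by simp) (by simp), shift_apply (by simp) (by simp)]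
      simp only [conf, update_conf_bits]
  have h₃ := runs_pour (k := Stk.aux) (t := Stk.rel m) (by simp)
    (shift (.rel m) .aux a (conf w D ρ R (b :: B) N))
  have e : update (update (shift (.rel m) .aux a (conf w D ρ R (b :: B) N)) .aux []) (.rel m)
      ((shift (.rel m) .aux a (conf w D ρ R (b :: B) N) .aux).reverse ++
        shift (.rel m) .aux a (conf w D ρ R (b :: B) N) (.rel m)) =
      conf w D ρ R (b :: B) N := by
    funext k
    by_cases h₁ : k = .rel m
    · subst h₁; simp [shift, conf]
    by_cases h₂ : k = .aux
    · subst h₂; simp [shift, conf]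
    simp [shift, h₁, h₂]
  rw [e] at h₃
  refine (h₁.seq (h₂.seq h₃)).mono ?_
  simp only [eval_add, eval_mul, eval_X, eval_ofNat, eval_one, eval_pow]
  gcongr
  simp only [shift, conf, List.append_nil, update_self, List.length_reverse]
  exact (List.length_take_le' _ _).trans hlen

/-- Pushes to `bits` whether the letter at position `x` satisfies `p`. -/
def testLetter (p : Letter → Bool) (x : V) : Cmd (Stk V M J) Letter :=
  .pop (.right x) fun o =>
    match o with
    | none => .push .bits (.bit false)
    | some a => .seq (.push (.right x) a) (.push .bits (.bit (p a)))

theorem runs_testLetter (p : Letter → Bool) (x : V) (w : List Letter)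
    (D : Fin J → List Letter × List Letter) (ρ : V → ℕ) (R : M → List Letter) (B N : List Letter)
    (hx : ρ x < w.length) :
    Runs (testLetter p x) (conf w D ρ R B N) (conf w D ρ R (.bit (p w[ρ x]) :: B) N) 3 := by
  have hdrop : conf w D ρ R B N (.right x) = w[ρ x] :: w.drop (ρ x + 1) := by
    simp [conf]
  refine Runs.pop (n := 1 + 1) ?_
  rw [hdrop]
  refine Runs.seq (t := conf w D ρ R B N) ?_ ?_
  · refine Runs.push_eq ?_
    simp only [List.tail_cons, update_self, update_idem]
    rw [← hdrop, update_eq_self]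
  · exact Runs.push_eq (update_conf_bits ..).symm

/-- Pushes to `bits` whether `x ≤ y`; the stack `aux` serves as a counter. -/
def testLe (x y : V) : Cmd (Stk V M J) Letter :=
  .seq (each (.left x) .tmp (.push .aux .sep))
    (.seq (each (.left y) .tmp (.pop .aux fun _ => .skip))
      (.seq (.pop .aux fun o =>
          match o with
          | none => .push .bits (.bit true)
          | some _ => .push .bits (.bit false))
        (clear .aux)))

theorem runs_testLe (x y : V) (w : List Letter)
    (D : Fin J → List Letter × List Letter) (ρ : V → ℕ) (R : M → List Letter) (B N : List Letter)
    (hx : ρ x < w.length) (hy : ρ y < w.length) :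
    Runs (testLe x y) (conf w D ρ R B N) (conf w D ρ R (.bit (decide (ρ x ≤ ρ y)) :: B) N)
      (13 * w.length + 7) := by
  set s := conf w D ρ R B N with hs
  have hlx : ((w.take (ρ x)).reverse).length = ρ x := by simp [hx.le]
  have hly : ((w.take (ρ y)).reverse).length = ρ y := by simp [hy.le]
  have h₁ := runs_each (k := Stk.left x) (t := Stk.tmp) (c := .push .aux .sep) (n := 1) (by simp)
    (fun i => update s .aux (List.replicate i .sep)) ((w.take (ρ x)).reverse)
    (by simp [hs, conf]) (by simp [hs, conf]) (by simp [hs, conf]) (by simp [hs, conf])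
    (fun i _ l₁ l₂ => by
      refine Runs.push_eq ?_
      rw [update_comm (by simp), update_comm (by simp),
        update_comm (a := Stk.tmp) (b := Stk.aux) (by simp),
        update_comm (a := Stk.left x) (b := Stk.aux) (by simp), update_idem]
      simp [List.replicate_succ])
  have h₂ := runs_each (k := Stk.left y) (t := Stk.tmp) (c := .pop .aux fun _ => .skip) (n := 2)
    (by simp) (fun i => update s .aux (List.replicate (ρ x - i) .sep)) ((w.take (ρ y)).reverse)
    (by simp [hs, conf]) (by simp [hs, conf]) (by simp [hs, conf]) (by simp [hs, conf])
    (fun i _ l₁ l₂ => by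
      refine Runs.pop (n := 1) ?_
      refine Runs.skip_eq ?_
      rw [update_comm (by simp), update_comm (by simp),
        update_comm (a := Stk.tmp) (b := Stk.aux) (by simp),
        update_comm (a := Stk.left y) (b := Stk.aux) (by simp), update_idem]
      simp [List.tail_replicate, Nat.sub_sub])
  rw [hlx] at h₁
  rw [hly] at h₂
  have e₀ : update s .aux (List.replicate 0 .sep) = s := by
    have : s .aux = List.replicate 0 .sep := rfl
    rw [← this, update_eq_self]
  rw [e₀] at h₁
  rw [Nat.sub_zero] at h₂
  have h₃ : Runs (.pop .aux fun o =>
      match o with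
      | none => .push .bits (.bit true)
      | some _ => .push .bits (.bit false)) (update s .aux (List.replicate (ρ x - ρ y) .sep))
      (update (conf w D ρ R (.bit (decide (ρ x ≤ ρ y)) :: B) N) .aux
        (List.replicate (ρ x - ρ y - 1) .sep)) 2 := by
    refine Runs.pop (n := 1) ?_
    rw [update_self, update_idem, List.tail_replicate, ← update_conf_bits (B := B),
      update_comm (by simp)]
    by_cases hxy : ρ x ≤ ρ y
    · simp only [Nat.sub_eq_zero_of_le hxy, List.replicate_zero, List.head?_nil, hxy, decide_true]
      refine Runs.push_eq ?_
      simp [hs, conf]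
    · obtain ⟨k, hk⟩ : ∃ k, ρ x - ρ y = k + 1 := ⟨ρ x - ρ y - 1, by omega⟩
      simp only [hk, List.replicate_succ, List.head?_cons, hxy, decide_false]
      refine Runs.push_eq ?_
      simp [hs, conf]
  have h₄ := runs_clear Stk.aux (update (conf w D ρ R (.bit (decide (ρ x ≤ ρ y)) :: B) N) .aux
        (List.replicate (ρ x - ρ y - 1) .sep))
  rw [update_idem] at h₄
  have e₁ : update (conf w D ρ R (.bit (decide (ρ x ≤ ρ y)) :: B) N) .aux [] =
      conf w D ρ R (.bit (decide (ρ x ≤ ρ y)) :: B) N := by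
    exact update_eq_self (Stk.aux : Stk V M J) (conf w D ρ R _ N)
  rw [e₁] at h₄
  refine (h₁.seq (h₂.seq (h₃.seq h₄))).mono ?_
  simp only [update_self, List.length_replicate]
  omega

/-- Runs `c` for all positions `x`, in increasing order. -/
def forVar (x : V) (c : Cmd (Stk V M J) Letter) : Cmd (Stk V M J) Letter :=
  .seq (.loop (.right x) fun a => .seq (.push (.right x) a) (.seq c
      (.seq (.pop (.right x) fun _ => .skip) (.push (.left x) a))))
    (pour (.left x) (.right x))

theorem runs_forVar (x : V) {c : Cmd (Stk V M J) Letter} {n : ℕ} (w : List Letter)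
    (D : Fin J → List Letter × List Letter) (ρ : V → ℕ) (R : M → List Letter)
    (B N : ℕ → List Letter) (hx : ρ x = 0)
    (hc : ∀ d < w.length, Runs c (conf w D (update ρ x d) R (B d) (N d))
      (conf w D (update ρ x d) R (B (d + 1)) (N (d + 1))) n) :
    Runs (forVar x c) (conf w D ρ R (B 0) (N 0)) (conf w D ρ R (B w.length) (N w.length))
      ((n + 7) * w.length + 2) := by
  have key : ∀ k d, d + k = w.length →
      Runs (.loop (.right x) fun a => .seq (.push (.right x) a) (.seq c
        (.seq (.pop (.right x) fun _ => .skip) (.push (.left x) a))))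
        (conf w D (update ρ x d) R (B d) (N d))
        (conf w D (update ρ x w.length) R (B w.length) (N w.length)) ((n + 5) * k + 1) := by
    intro k
    induction k with
    | zero =>
      intro d hd
      obtain rfl : d = w.length := by omega
      exact Runs.mono (.loop_nil (by simp [conf])) (by simp)
    | succ k ih =>
      intro d hd
      have hd' : d < w.length := by omega
      have hdrop : w.drop d = w[d] :: w.drop (d + 1) := List.drop_eq_getElem_cons hd'
      have hs : ∀ B N : List Letter, conf w D (update ρ x d) R B N (Stk.right x : Stk V M J) =
          w[d] :: w.drop (d + 1) := by
        intro B N; simp [conf]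
      refine Runs.mono (.loop_cons (hs _ _) (.seq (m := 1)
        (t := conf w D (update ρ x d) R (B d) (N d)) ?_ (.seq (hc d hd') (.seq (m := 2) (n := 1)
          (t := update (conf w D (update ρ x d) R (B (d + 1)) (N (d + 1))) (.right x)
            (w.drop (d + 1)))
          ?_ ?_))) (ih (d + 1) (by omega))) (by ring_nf; omega)
      · refine Runs.push_eq ?_
        rw [update_idem, update_self, ← hs, update_eq_self]
      · refine Runs.pop (n := 1) ?_
        rw [hs, List.tail_cons]
        exact Runs.skip _
      · refine Runs.push_eq ?_
        have h := update_conf_var w D (update ρ x d) R (B (d + 1)) (N (d + 1)) x (d + 1)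
        rw [update_idem] at h
        rw [← h, update_comm (by simp)]
        congr 1
        have e : (w.take (d + 1)).reverse = w[d] :: (w.take d).reverse := by
          rw [List.take_succ_eq_append_getElem hd', List.reverse_append]; rfl
        rw [e, update_of_ne (by simp)]
        simp only [conf, update_self]
  have h₁ := key w.length 0 (by omega)
  have e₀ : update ρ x 0 = ρ := by rw [← hx, update_eq_self]
  rw [e₀] at h₁
  have h₂ := runs_pour (k := Stk.left x) (t := Stk.right x) (by simp)
    (conf w D (update ρ x w.length) R (B w.length) (N w.length))
  have e₁ := update_conf_var w D (update ρ x w.length) R (B w.length) (N w.length) x 0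
  rw [update_idem, e₀] at e₁
  have e₂ : update (update (conf w D (update ρ x w.length) R (B w.length) (N w.length))
      (.left x) []) (.right x)
      ((conf w D (update ρ x w.length) R (B w.length) (N w.length) (.left x)).reverse ++
        conf w D (update ρ x w.length) R (B w.length) (N w.length) (.right x)) =
      conf w D ρ R (B w.length) (N w.length) := by
    rw [← e₁]
    simp only [conf, update_self, List.take_length, List.drop_length, List.reverse_reverse,
      List.append_nil, List.take_zero, List.drop_zero, List.reverse_nil]
  rw [e₂] at h₂
  refine (h₁.seq h₂).mono ?_
  simp [conf]
  ring_nf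
  omega

/-! ### First-order formulas over the positions of a word -/

/-- First-order formulas with variables `V` that range over the positions of a word, and with
relation symbols `M`. -/
inductive Fml (V M : Type) : Type
  | letter (p : Letter → Bool) (x : V)
  | le (x y : V)
  | rel (m : M) (xs : List V)
  | not (φ : Fml V M)
  | and (φ ψ : Fml V M)
  | ex (x : V) (φ : Fml V M)

namespace Fml

/-- The truth of a formula in the word `w`, where `R` interprets the relation symbols and `ρ` the
variables. -/
def Holds (w : List Letter) (R : M → List ℕ → Prop) : Fml V M → (V → ℕ) → Prop
  | letter p x, ρ => ∃ a, w[ρ x]? = some a ∧ p a = true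
  | le x y, ρ => ρ x ≤ ρ y
  | rel m xs, ρ => R m (xs.map ρ)
  | not φ, ρ => ¬ φ.Holds w R ρ
  | and φ ψ, ρ => φ.Holds w R ρ ∧ ψ.Holds w R ρ
  | ex x φ, ρ => ∃ d < w.length, φ.Holds w R (update ρ x d)

/-- A formula is well formed if the relation symbols are used with their arities, and if no
quantifier binds a variable that is already in use; `used` lists those in use from the outside. -/
def WF (ar : M → ℕ) : List V → Fml V M → Bool
  | _, letter _ _ => true
  | _, le _ _ => true
  | _, rel m xs => decide (xs.length = ar m)
  | used, not φ => φ.WF ar used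
  | used, and φ ψ => φ.WF ar used && ψ.WF ar used
  | used, ex x φ => decide (x ∉ used) && φ.WF ar (x :: used)

end Fml

open Classical in
/-- The letter that represents the truth value of `p` on the stacks of the machine. -/
noncomputable def truth (p : Prop) : Letter := .bit (decide p)

theorem bit_decide (p : Prop) [Decidable p] : Letter.bit (decide p) = truth p := by
  unfold truth; congr

/-- The negation of a truth value on a stack. -/
def negLetter : Option Letter → Letter
  | some (.bit b) => .bit !b
  | _ => .sep

/-- The conjunction of two truth values on a stack. -/
def andLetter : Option Letter → Option Letter → Letter
  | some (.bit a), some (.bit b) => .bit (a && b)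
  | _, _ => .sep

/-- The disjunction of two truth values on a stack. -/
def orLetter : Option Letter → Option Letter → Letter
  | some (.bit a), some (.bit b) => .bit (a || b)
  | _, _ => .sep

theorem negLetter_truth (p : Prop) : negLetter (some (truth p)) = truth (¬ p) := by
  by_cases h : p <;> simp [negLetter, truth, h]

theorem andLetter_truth (p q : Prop) :
    andLetter (some (truth p)) (some (truth q)) = truth (p ∧ q) := by
  by_cases hp : p <;> by_cases hq : q <;> simp [andLetter, truth, hp, hq]

theorem orLetter_truth (p q : Prop) :
    orLetter (some (truth p)) (some (truth q)) = truth (p ∨ q) := by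
  by_cases hp : p <;> by_cases hq : q <;> simp [orLetter, truth, hp, hq]

/-- Replaces the two uppermost truth values by their combination. -/
def binOp (f : Option Letter → Option Letter → Letter) : Cmd (Stk V M J) Letter :=
  .pop .bits fun o₁ => .pop .bits fun o₂ => .push .bits (f o₁ o₂)

theorem runs_binOp (f : Option Letter → Option Letter → Letter) (w : List Letter)
    (D : Fin J → List Letter × List Letter) (ρ : V → ℕ) (R : M → List Letter) (B N : List Letter)
    (a b : Letter) :
    Runs (binOp f) (conf w D ρ R (a :: b :: B) N) (conf w D ρ R (f (some a) (some b) :: B) N) 3 := by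
  refine Runs.pop (n := 2) (Runs.pop (n := 1) (Runs.push_eq ?_))
  simp [conf, update_conf_bits]

/-- The program that pushes the truth value of a formula to the stack `bits`. -/
def Fml.compile [NeZero J] : Fml V M → Cmd (Stk V M J) Letter
  | letter p x => testLetter p x
  | le x y => testLe x y
  | rel m xs => lookup m xs
  | not φ => .seq φ.compile (.pop .bits fun o => .push .bits (negLetter o))
  | and φ ψ => .seq φ.compile (.seq ψ.compile (binOp andLetter))
  | ex x φ => .seq (.push .bits (.bit false)) (forVar x (.seq φ.compile (binOp orLetter)))

/-- All `k`-tuples of numbers below `n`, in lexicographic order. -/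
def tups (n : ℕ) : ℕ → List (List ℕ)
  | 0 => [[]]
  | k + 1 => (List.range n).flatMap fun d => (tups n k).map (d :: ·)

theorem length_tups (n k : ℕ) : (tups n k).length = n ^ k := by
  induction k with
  | zero => rfl
  | succ k ih => simp [tups, List.length_flatMap, ih, pow_succ']

theorem mem_tups {n k : ℕ} {l : List ℕ} : l ∈ tups n k ↔ l.length = k ∧ ∀ d ∈ l, d < n := by
  induction k generalizing l with
  | zero =>
    simp only [tups, List.mem_singleton, List.length_eq_zero_iff]
    exact ⟨fun h => ⟨h, by simp [h]⟩, fun h => h.1⟩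
  | succ k ih =>
    cases l with
    | nil => simp [tups]
    | cons d l => simp [tups, ih]; tauto

theorem flatMap_range_getElem? {β : Type} {k : ℕ} (f : ℕ → List β) (hf : ∀ d, (f d).length = k)
    {n d i : ℕ} (hd : d < n) (hi : i < k) :
    ((List.range n).flatMap f)[d * k + i]? = (f d)[i]? := by
  induction n with
  | zero => omega
  | succ n ih =>
    have hlen : ((List.range n).flatMap f).length = n * k := by
      simp [List.length_flatMap, hf]
    rw [List.range_succ, List.flatMap_append, List.flatMap_singleton]
    rcases Nat.lt_succ_iff_lt_or_eq.1 hd with h | rfl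
    · rw [List.getElem?_append_left, ih h]
      rw [hlen]
      calc d * k + i < d * k + k := by omega
        _ = (d + 1) * k := by ring
        _ ≤ n * k := Nat.mul_le_mul_right _ h
    · rw [List.getElem?_append_right (by omega), hlen, Nat.add_sub_cancel_left]

theorem addr_lt {n : ℕ} {l : List ℕ} (h : ∀ d ∈ l, d < n) : addr n l < n ^ l.length := by
  induction l with
  | nil => simp [addr]
  | cons d l ih =>
    simp only [List.mem_cons, forall_eq_or_imp] at h
    have := ih h.2
    calc addr n (d :: l) < d * n ^ l.length + n ^ l.length := by simpa [addr] using this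
      _ = (d + 1) * n ^ l.length := by ring
      _ ≤ n * n ^ l.length := Nat.mul_le_mul_right _ h.1
      _ = n ^ (d :: l).length := by simp [pow_succ']

theorem tups_getElem?_addr {n : ℕ} {l : List ℕ} (h : ∀ d ∈ l, d < n) :
    (tups n l.length)[addr n l]? = some l := by
  induction l with
  | nil => rfl
  | cons d l ih =>
    simp only [List.mem_cons, forall_eq_or_imp] at h
    rw [List.length_cons, tups, addr, flatMap_range_getElem? _ (fun _ => by
      rw [List.length_map, length_tups]) h.1 (addr_lt h.2), List.getElem?_map, ih h.2]
    rfl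

/-- The bit table of the relation `P` on tuples of length `k`. -/
noncomputable def table (n k : ℕ) (P : List ℕ → Prop) : List Letter :=
  (tups n k).map fun l => truth (P l)

theorem length_table (n k : ℕ) (P : List ℕ → Prop) : (table n k P).length = n ^ k := by
  simp [table, length_tups]

/-- The tables of all relations. -/
noncomputable def tables (w : List Letter) (ar : M → ℕ) (R : M → List ℕ → Prop) (m : M) :
    List Letter :=
  table w.length (ar m) (R m)

theorem Fml.exists_runs_compile [NeZero J] (ar : M → ℕ) (har : ∀ m, ar m ≤ J) (φ : Fml V M)
    (used : List V) (hφ : φ.WF ar used) :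
    ∃ p : ℕ[X], ∀ (w : List Letter) (D : Fin J → List Letter × List Letter) (ρ : V → ℕ)
      (R : M → List ℕ → Prop) (B N : List Letter), (∀ x, ρ x < w.length) →
      (∀ x ∉ used, ρ x = 0) →
      Runs φ.compile (conf w D ρ (tables w ar R) B N)
        (conf w D ρ (tables w ar R) (truth (φ.Holds w R ρ) :: B) N) (p.eval w.length) := by
  induction φ generalizing used with
  | letter p x =>
    refine ⟨3, fun w D ρ R B N hρ _ => ?_⟩
    have := runs_testLetter p x w D ρ (tables w ar R) B N (hρ x)
    rw [← Bool.decide_coe (p (w[ρ x]'(hρ x))), bit_decide] at this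
    simpa [Holds, compile, hρ x] using this
  | le x y =>
    refine ⟨13 * X + 7, fun w D ρ R B N hρ _ => ?_⟩
    have := runs_testLe x y w D ρ (tables w ar R) B N (hρ x) (hρ y)
    rw [bit_decide] at this
    simpa [Holds, compile] using this
  | rel m xs =>
    simp only [WF, decide_eq_true_eq] at hφ
    obtain ⟨p, hp⟩ := exists_runs_lookup (J := J) m xs (hφ ▸ har m)
    refine ⟨p, fun w D ρ R B N hρ _ => hp w D ρ _ B N _ hρ ?_ ?_⟩
    · rw [tables, length_table, hφ]
    · have := tups_getElem?_addr (n := w.length) (l := xs.map ρ) (by simpa using fun x _ => hρ x)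
      rw [List.length_map, hφ] at this
      simp [tables, table, List.getElem?_map, this, Holds]
  | not φ ih =>
    obtain ⟨p, hp⟩ := ih used hφ
    refine ⟨p + 2, fun w D ρ R B N hρ h0 => ?_⟩
    refine ((hp w D ρ R B N hρ h0).seq (n := 2) (Runs.pop (n := 1) (Runs.push_eq ?_))).mono (by simp)
    simp [conf, update_conf_bits, negLetter_truth, Holds]
  | and φ ψ ih₁ ih₂ =>
    simp only [WF, Bool.and_eq_true] at hφ
    obtain ⟨p, hp⟩ := ih₁ used hφ.1
    obtain ⟨q, hq⟩ := ih₂ used hφ.2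
    refine ⟨p + (q + 3), fun w D ρ R B N hρ h0 => ?_⟩
    refine ((hp w D ρ R B N hρ h0).seq ((hq w D ρ R _ N hρ h0).seq
      (t := conf w D ρ (tables w ar R) _ N) (n := 3) ?_)).mono (by simp)
    convert runs_binOp andLetter w D ρ (tables w ar R) B N _ _ using 2
    rw [andLetter_truth, and_comm]
    rfl
  | ex x φ ih =>
    simp only [WF, Bool.and_eq_true, decide_eq_true_eq] at hφ
    obtain ⟨p, hp⟩ := ih (x :: used) hφ.2
    refine ⟨1 + ((p + 3 + 7) * X + 2), fun w D ρ R B N hρ h0 => ?_⟩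
    let b : ℕ → Letter := fun n => truth (∃ d < n, φ.Holds w R (update ρ x d))
    have h₁ : Runs (.push .bits (.bit false)) (conf w D ρ (tables w ar R) B N)
        (conf w D ρ (tables w ar R) (b 0 :: B) N) 1 := by
      refine Runs.push_eq ?_
      simp [b, conf, update_conf_bits, truth]
    have h₂ := runs_forVar x (c := .seq φ.compile (binOp orLetter)) (n := p.eval w.length + 3)
      w D ρ (tables w ar R) (fun d => b d :: B) (fun _ => N) (h0 x hφ.1) (fun d hd => by
        refine (hp w D (update ρ x d) R _ N ?_ ?_).seq (n := 3) ?_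
        · intro y
          by_cases h : y = x <;> simp [h, hd, hρ]
        · intro y hy
          simp only [List.mem_cons, not_or] at hy
          rw [update_of_ne hy.1, h0 y hy.2]
        · convert runs_binOp orLetter w D (update ρ x d) (tables w ar R) B N _ _ using 3
          simp only [b, orLetter_truth]
          congr 1
          simp only [Nat.lt_succ_iff_lt_or_eq, or_and_right, exists_or, exists_eq_left]
          rw [or_comm])
    exact (h₁.seq h₂).mono (by simp)

/-! ### Inductive definitions of relations -/

/-- The assignment that maps the variables `xs` to the positions `l`. -/
def setEnv (ρ : V → ℕ) : List V → List ℕ → V → ℕ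
  | x :: xs, d :: l => setEnv (update ρ x d) xs l
  | _, _ => ρ

theorem setEnv_of_notMem {ρ : V → ℕ} {xs : List V} {l : List ℕ} {x : V} (h : x ∉ xs) :
    setEnv ρ xs l x = ρ x := by
  induction xs generalizing ρ l with
  | nil => simp [setEnv]
  | cons y xs ih =>
    cases l with
    | nil => simp [setEnv]
    | cons d l =>
      simp only [List.mem_cons, not_or] at h
      rw [setEnv, ih h.2, update_of_ne h.1]

theorem map_setEnv {ρ : V → ℕ} {xs : List V} {l : List ℕ} (hxs : xs.Nodup)
    (hl : l.length = xs.length) : xs.map (setEnv ρ xs l) = l := by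
  induction xs generalizing ρ l with
  | nil => simpa [eq_comm] using hl
  | cons y xs ih =>
    cases l with
    | nil => simp at hl
    | cons d l =>
      rw [List.nodup_cons] at hxs
      rw [List.map_cons, setEnv, ih hxs.2 (by simpa using hl), setEnv_of_notMem hxs.1, update_self]

theorem setEnv_lt {n : ℕ} {ρ : V → ℕ} (hρ : ∀ x, ρ x < n) (xs : List V) {l : List ℕ}
    (hl : ∀ d ∈ l, d < n) (x : V) : setEnv ρ xs l x < n := by
  induction xs generalizing ρ l with
  | nil => simpa [setEnv] using hρ x
  | cons y xs ih =>
    cases l with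
    | nil => simpa [setEnv] using hρ x
    | cons d l =>
      simp only [List.mem_cons, forall_eq_or_imp] at hl
      refine ih (fun z => ?_) hl.2
      by_cases h : z = y <;> simp [h, hl.1, hρ]

/-- Runs `c` for all values of the variables `xs`, in lexicographic order. -/
def forAll : List V → Cmd (Stk V M J) Letter → Cmd (Stk V M J) Letter
  | [], c => c
  | x :: xs, c => forVar x (forAll xs c)

theorem exists_runs_forAll (xs : List V) (hxs : xs.Nodup) (p : ℕ[X]) :
    ∃ q : ℕ[X], ∀ (c : Cmd (Stk V M J) Letter) (w : List Letter)
      (D : Fin J → List Letter × List Letter) (ρ : V → ℕ) (R : M → List Letter) (B N : List Letter)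
      (f : List ℕ → Letter), (∀ x ∈ xs, ρ x = 0) →
      (∀ l ∈ tups w.length xs.length, ∀ N, Runs c (conf w D (setEnv ρ xs l) R B N)
        (conf w D (setEnv ρ xs l) R B (f l :: N)) (p.eval w.length)) →
      Runs (forAll xs c) (conf w D ρ R B N)
        (conf w D ρ R B (((tups w.length xs.length).map f).reverse ++ N)) (q.eval w.length) := by
  induction xs with
  | nil => exact ⟨p, fun c w D ρ R B N f _ h => by
    simpa [tups, setEnv, forAll] using h [] (by simp [tups]) N⟩
  | cons x xs ih =>
    rw [List.nodup_cons] at hxs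
    obtain ⟨q, hq⟩ := ih hxs.2
    refine ⟨(q + 7) * X + 2, fun c w D ρ R B N f h0 h => ?_⟩
    let N' : ℕ → List Letter := fun n =>
      (((List.range n).flatMap fun d => (tups w.length xs.length).map (d :: ·)).map f).reverse ++ N
    refine (runs_forVar x (n := q.eval w.length) w D ρ R (fun _ => B) N' (h0 x (by simp))
      fun d hd => ?_).mono (by simp)
    have := hq c w D (update ρ x d) R B (N' d) (fun l => f (d :: l))
      (fun y hy => by
        rw [update_of_ne (by rintro rfl; exact hxs.1 hy)]
        exact h0 y (by simp [hy]))
      (fun l hl N => by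
        refine h (d :: l) ?_ N
        rw [mem_tups] at hl ⊢
        simpa [hl.1, hd] using hl.2)
    convert this using 2
    simp [N', List.range_succ, List.flatMap_append, Function.comp_def]

/-- Sets the relation `m` to that of all tuples `xs` for which the program `c` yields true. -/
def assign (m : M) (xs : List V) (c : Cmd (Stk V M J) Letter) : Cmd (Stk V M J) Letter :=
  .seq (forAll xs (.seq c (moveOne .bits .new))) (.seq (clear (.rel m)) (pour .new (.rel m)))

/-- The relation of all tuples `xs` of positions that are in the relation of `m` already, or that
satisfy `φ`. -/
def stage (w : List Letter) (R : M → List ℕ → Prop) (m : M) (xs : List V) (φ : Fml V M)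
    (l : List ℕ) : Prop :=
  l ∈ tups w.length xs.length ∧ (R m l ∨ φ.Holds w R (setEnv (fun _ => 0) xs l))

theorem update_tables (w : List Letter) (ar : M → ℕ) (R : M → List ℕ → Prop) (m : M)
    (P : List ℕ → Prop) :
    update (tables w ar R) m (table w.length (ar m) P) = tables w ar (update R m P) := by
  funext m'
  by_cases h : m' = m
  · subst h; simp [tables]
  · simp [tables, h]

/-- The disjunction of formulas. -/
def Fml.or (φ ψ : Fml V M) : Fml V M := .not (.and (.not φ) (.not ψ))

omit [DecidableEq M] in
@[simp] theorem Fml.holds_or {w : List Letter} {R : M → List ℕ → Prop} {φ ψ : Fml V M}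
    {ρ : V → ℕ} : (φ.or ψ).Holds w R ρ ↔ φ.Holds w R ρ ∨ ψ.Holds w R ρ := by
  simp only [Fml.or, Holds]; tauto

theorem exists_runs_assign [NeZero J] (ar : M → ℕ) (har : ∀ m, ar m ≤ J) (m : M) (xs : List V)
    (φ : Fml V M) (hxs : xs.Nodup) (hm : xs.length = ar m) (hφ : φ.WF ar xs) :
    ∃ p : ℕ[X], ∀ (w : List Letter) (D : Fin J → List Letter × List Letter)
      (R : M → List ℕ → Prop), w ≠ [] →
      Runs (assign m xs (Fml.compile (.or (.rel m xs) φ)))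
        (conf w D (fun _ => 0) (tables w ar R) [] [])
        (conf w D (fun _ => 0) (tables w ar (update R m (stage w R m xs φ))) [] [])
        (p.eval w.length) := by
  obtain ⟨p, hp⟩ := Fml.exists_runs_compile ar har (.or (.rel m xs) φ) xs
    (by simp [Fml.or, Fml.WF, hm, hφ])
  obtain ⟨q, hq⟩ := exists_runs_forAll (M := M) (J := J) xs hxs (p + 2)
  refine ⟨q + ((2 * X ^ xs.length + 1) + (2 * X ^ xs.length + 1)), fun w D R hw => ?_⟩
  have hpos : 0 < w.length := List.length_pos_iff.2 hw
  have h₁ := hq (.seq (Fml.compile (.or (.rel m xs) φ)) (moveOne .bits .new)) w D (fun _ => 0)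
    (tables w ar R) [] [] (fun l => truth (stage w R m xs φ l)) (fun _ _ => rfl)
    (fun l hl N => by
      have hl' := mem_tups.1 hl
      have h₁ := hp w D (setEnv (fun _ => 0) xs l) R [] N (setEnv_lt (fun _ => hpos) xs hl'.2)
        (fun x hx => setEnv_of_notMem hx)
      have h₂ := runs_moveOne (r := Stk.bits) (t := Stk.new) (by simp)
        (conf w D (setEnv (fun _ => 0) xs l) (tables w ar R)
          [truth ((Fml.or (.rel m xs) φ).Holds w R (setEnv (fun _ => 0) xs l))] N)
      have e : stage w R m xs φ l =
          (Fml.or (.rel m xs) φ).Holds w R (setEnv (fun _ => 0) xs l) := by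
        rw [Fml.holds_or, Fml.Holds, map_setEnv hxs hl'.1]
        simp [stage, hl]
      rw [← e] at h₁ h₂
      have e' : shift Stk.bits Stk.new 1 (conf w D (setEnv (fun _ => 0) xs l) (tables w ar R)
          [truth (stage w R m xs φ l)] N) = conf w D (setEnv (fun _ => 0) xs l) (tables w ar R) []
            (truth (stage w R m xs φ l) :: N) := by
        simp [shift, conf, update_conf_bits, update_conf_new]
      rw [e'] at h₂
      exact (h₁.seq h₂).mono (by simp))
  have h₂ := runs_clear (Stk.rel m : Stk V M J) (conf w D (fun _ => 0) (tables w ar R) []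
    (((tups w.length xs.length).map fun l => truth (stage w R m xs φ l)).reverse ++ []))
  rw [update_conf_rel] at h₂
  have h₃ := runs_pour (k := (Stk.new : Stk V M J)) (t := Stk.rel m) (by simp)
    (conf w D (fun _ => 0) (update (tables w ar R) m []) []
      (((tups w.length xs.length).map fun l => truth (stage w R m xs φ l)).reverse ++ []))
  rw [update_conf_new, update_conf_rel] at h₃
  have e : update (update (tables w ar R) m []) m (((((tups w.length xs.length).map
      fun l => truth (stage w R m xs φ l)).reverse ++ []).reverse) ++
        (update (tables w ar R) m []) m) = tables w ar (update R m (stage w R m xs φ)) := by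
    rw [← update_tables, update_idem]
    simp [table, hm]
  change Runs _ _ (conf w D (fun _ => 0) (update (update (tables w ar R) m []) m
    (((((tups w.length xs.length).map fun l => truth (stage w R m xs φ l)).reverse ++
      []).reverse) ++ (update (tables w ar R) m []) m)) [] []) _ at h₃
  rw [e] at h₃
  refine (h₁.seq (h₂.seq h₃)).mono ?_
  simp [conf, length_tups, tables, length_table, hm]

/-- Sets the relation `m` to the empty relation of arity `k`. -/
noncomputable def reset [NeZero J] (m : M) (k : ℕ) : Cmd (Stk V M J) Letter :=
  .seq (clear (.rel m)) (tupleLoop false k (.push (.rel m) (truth False)))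

theorem exists_runs_reset [NeZero J] (m : M) (k : ℕ) (hk : k ≤ J) :
    ∃ p : ℕ[X], ∀ (w : List Letter) (D : Fin J → List Letter × List Letter) (ρ : V → ℕ)
      (R : M → List Letter) (B N : List Letter), (R m).length ≤ w.length ^ k →
      Runs (reset m k) (conf w D ρ R B N)
        (conf w D ρ (update R m (table w.length k fun _ => False)) B N) (p.eval w.length) := by
  obtain ⟨q, hq⟩ := exists_runs_tupleLoop (V := V) (M := M) (J := J) (A := Letter) false k hk 1
  refine ⟨2 * X ^ k + 1 + q, fun w D ρ R B N hR => ?_⟩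
  have h₁ := runs_clear (Stk.rel m) (conf w D ρ R B N)
  rw [update_conf_rel] at h₁
  let I : ℕ → Stk V M J → List Letter := fun i =>
    conf w D ρ (update R m (List.replicate i (truth False))) B N
  have hput : ∀ i, put false (fun _ => (w, [])) (I i) = I i := fun i =>
    put_self fun j => by simp [I, conf]
  have h₂ := hq (.push (.rel m) (truth False)) w I (fun _ => (w, [])) (fun _ _ => rfl)
    (fun i _ D' => by
      refine (Runs.push_eq ?_).mono (by simp) (m := 1)
      simp only [I, ← update_conf_rel]
      funext k
      cases k with
      | rel m' => by_cases h : m' = m <;> simp [put, h, List.replicate_succ]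
      | _ => simp [put])
  rw [hput, hput] at h₂
  have e : List.replicate (w.length ^ k) (truth False) = table w.length k fun _ => False := by
    simp [table, length_tups]
  simp only [I, e] at h₂
  refine (h₁.seq h₂).mono ?_
  simpa [conf] using hR

/-- The inductive definition of the relation `m`: beginning with the empty relation, the tuples
`vars` for which `body` holds are added, until there are no more of them; `body` may mention `m`. -/
structure IndDef (V M : Type) where
  m : M
  vars : List V
  body : Fml V M

namespace IndDef

/-- The stages of an inductive definition, beginning with the empty relation. -/
def stages (w : List Letter) (R : M → List ℕ → Prop) (d : IndDef V M) : ℕ → List ℕ → Prop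
  | 0 => fun _ => False
  | k + 1 => stage w (update R d.m (d.stages w R k)) d.m d.vars d.body

/-- The relation that is defined by `d`: the stage after as many steps as there are tuples. -/
def value (w : List Letter) (R : M → List ℕ → Prop) (d : IndDef V M) : List ℕ → Prop :=
  d.stages w R (w.length ^ d.vars.length)

/-- An inductive definition is well formed if the arities fit, and the variables are distinct and
not bound in the body. -/
def WF (ar : M → ℕ) (d : IndDef V M) : Bool :=
  decide (d.vars.Nodup) && decide (d.vars.length = ar d.m) && d.body.WF ar d.vars

/-- The program that computes the relation that is defined by `d`. -/
noncomputable def compile [NeZero J] (d : IndDef V M) : Cmd (Stk V M J) Letter :=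
  .seq (reset d.m d.vars.length) (tupleLoop true d.vars.length
    (assign d.m d.vars (Fml.compile (.or (.rel d.m d.vars) d.body))))

theorem exists_runs_compile [NeZero J] (ar : M → ℕ) (har : ∀ m, ar m ≤ J) (d : IndDef V M)
    (hd : d.WF ar) :
    ∃ p : ℕ[X], ∀ (w : List Letter) (R : M → List ℕ → Prop), w ≠ [] →
      Runs (compile d) (conf (J := J) w (fun _ => (w, [])) (fun _ => 0) (tables w ar R) [] [])
        (conf w (fun _ => (w, [])) (fun _ => 0) (tables w ar (update R d.m (d.value w R))) [] [])
        (p.eval w.length) := by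
  simp only [WF, Bool.and_eq_true, decide_eq_true_eq] at hd
  obtain ⟨⟨hd₁, hd₂⟩, hd₃⟩ := hd
  obtain ⟨p, hp⟩ := exists_runs_assign ar har d.m d.vars d.body hd₁ hd₂ hd₃
  have hJ : d.vars.length ≤ J := hd₂ ▸ har d.m
  obtain ⟨q, hq⟩ := exists_runs_reset (V := V) d.m d.vars.length hJ
  obtain ⟨r, hr⟩ := exists_runs_tupleLoop (V := V) (M := M) (J := J) (A := Letter) true
    d.vars.length hJ p
  refine ⟨q + r, fun w R hw => ?_⟩
  have h₁ := hq w (fun _ => (w, [])) (fun _ => 0) (tables w ar R) [] []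
    (by rw [tables, length_table, hd₂])
  have h₂ := hr (assign d.m d.vars (Fml.compile (.or (.rel d.m d.vars) d.body))) w
    (fun i => conf w (fun _ => (w, [])) (fun _ => 0)
      (tables w ar (update R d.m (d.stages w R i))) [] []) (fun _ => (w, [])) (fun _ _ => rfl)
    (fun i _ D => by
      simp only [put_true_conf]
      simpa [stages] using hp w D (update R d.m (d.stages w R i)) hw)
  simp only [put_true_conf] at h₂
  rw [hd₂, update_tables, ← hd₂] at h₁
  exact (h₁.seq h₂).mono (by simp)

end IndDef

/-- The relations after a list of inductive definitions, each of which may mention the relations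
defined before. -/
def valueAll (w : List Letter) : List (IndDef V M) → (M → List ℕ → Prop) → M → List ℕ → Prop
  | [], R => R
  | d :: ds, R => valueAll w ds (update R d.m (d.value w R))

/-- The program that computes the relations of a list of inductive definitions. -/
noncomputable def compileAll [NeZero J] : List (IndDef V M) → Cmd (Stk V M J) Letter
  | [] => .skip
  | d :: ds => .seq d.compile (compileAll ds)

theorem exists_runs_compileAll [NeZero J] (ar : M → ℕ) (har : ∀ m, ar m ≤ J)
    (ds : List (IndDef V M)) (hds : ∀ d ∈ ds, d.WF ar) :
    ∃ p : ℕ[X], ∀ (w : List Letter) (R : M → List ℕ → Prop), w ≠ [] →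
      Runs (compileAll ds) (conf (J := J) w (fun _ => (w, [])) (fun _ => 0) (tables w ar R) [] [])
        (conf w (fun _ => (w, [])) (fun _ => 0) (tables w ar (valueAll w ds R)) [] [])
        (p.eval w.length) := by
  induction ds with
  | nil => exact ⟨1, fun w R _ => by simpa [compileAll, valueAll] using Runs.skip _⟩
  | cons d ds ih =>
    simp only [List.mem_cons, forall_eq_or_imp] at hds
    obtain ⟨p, hp⟩ := d.exists_runs_compile ar har hds.1
    obtain ⟨q, hq⟩ := ih hds.2
    exact ⟨p + q, fun w R hw => ((hp w R hw).seq (hq w _ hw)).mono (by simp)⟩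

/-- Sets all relations in a list to the empty relation. -/
noncomputable def resetAll [NeZero J] (ar : M → ℕ) : List M → Cmd (Stk V M J) Letter
  | [] => .skip
  | m :: ms => .seq (reset m (ar m)) (resetAll ar ms)

theorem exists_runs_resetAll [NeZero J] (ar : M → ℕ) (har : ∀ m, ar m ≤ J) (ms : List M) :
    ∃ p : ℕ[X], ∀ (w : List Letter) (D : Fin J → List Letter × List Letter) (ρ : V → ℕ)
      (R : M → List Letter) (B N : List Letter), (∀ m, (R m).length ≤ w.length ^ ar m) →
      Runs (resetAll ar ms) (conf w D ρ R B N) (conf w D ρ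
        (fun m => if m ∈ ms then table w.length (ar m) fun _ => False else R m) B N)
        (p.eval w.length) := by
  induction ms with
  | nil => exact ⟨1, fun w D ρ R B N _ => by simpa [resetAll] using Runs.skip _⟩
  | cons m ms ih =>
    obtain ⟨p, hp⟩ := ih
    obtain ⟨q, hq⟩ := exists_runs_reset (V := V) m (ar m) (har m)
    refine ⟨q + p, fun w D ρ R B N hR => ?_⟩
    have h₂ := hp w D ρ (update R m (table w.length (ar m) fun _ => False)) B N (fun m' => by
      by_cases h : m' = m
      · subst h; simp [length_table]
      · simpa [h] using hR m')
    have h₁ := ((hq w D ρ R B N (hR m)).seq h₂).mono (n := (q + p).eval w.length) (by simp)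
    rw [resetAll]
    convert h₁ using 2
    funext m'
    by_cases h : m' = m
    · subst h; simp
    · simp [h]

/-! ### Properties defined by formulas are decidable in polynomial time -/

/-- Pushes a symbol to all stacks in a list. -/
def pushAll (a : A) : List K → Cmd K A
  | [] => .skip
  | k :: ks => .seq (.push k a) (pushAll a ks)

theorem runs_pushAll (a : A) (ks : List K) (hks : ks.Nodup) (s : K → List A) :
    Runs (pushAll a ks) s (fun k => if k ∈ ks then a :: s k else s k) (ks.length + 1) := by
  induction ks generalizing s with
  | nil => simpa [pushAll] using Runs.skip s
  | cons k ks ih =>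
    rw [List.nodup_cons] at hks
    have h := (Runs.push k a s).seq (ih hks.2 (update s k (a :: s k)))
    rw [pushAll]
    convert h using 1
    · funext j
      by_cases hj : j = k
      · subst hj; simp [hks.1]
      · simp [hj]
    · simp [add_comm, add_left_comm]

/-- Moves a word from the stack `k` to all stacks in a list, with its first letter on top. -/
def load (k t : K) (ks : List K) : Cmd K A :=
  .seq (pour k t) (.loop t fun a => pushAll a ks)

theorem runs_load {k t : K} (h : k ≠ t) (ks : List K) (hks : ks.Nodup) (ht : t ∉ ks)
    (w : List A) :
    Runs (load k t ks) (update (fun _ => []) k w) (fun j => if j ∈ ks then w else [])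
      ((ks.length + 4) * w.length + 2) := by
  have key : ∀ r l : List A, Runs (.loop t fun a => pushAll a ks)
      (update (fun j => if j ∈ ks then l else []) t r)
      (fun j => if j ∈ ks then r.reverse ++ l else []) ((ks.length + 2) * r.length + 1) := by
    intro r
    induction r with
    | nil =>
      intro l
      have h : Runs (.loop t fun a => pushAll a ks)
          (update (fun j => if j ∈ ks then l else []) t [])
          (update (fun j => if j ∈ ks then l else []) t []) 1 := Runs.loop_nil (by simp)
      convert h using 1
      funext j
      by_cases hj : j = t
      · subst hj; simp [ht]
      · simp [hj]
      · simp
    | cons a r ih =>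
      intro l
      have h₁ := runs_pushAll a ks hks (update (fun j => if j ∈ ks then l else []) t r)
      have e : (fun j => if j ∈ ks then a :: update (fun j => if j ∈ ks then l else []) t r j
          else update (fun j => if j ∈ ks then l else []) t r j) =
          update (fun j => if j ∈ ks then a :: l else []) t r := by
        funext j
        by_cases hj : j = t
        · subst hj; simp [ht]
        · by_cases hj' : j ∈ ks <;> simp [hj, hj']
      rw [e] at h₁
      have h₂ := ih (a :: l)
      have h := (Runs.loop_cons (a := a) (l := r) (f := fun a => pushAll a ks)
        (s := update (fun j => if j ∈ ks then l else []) t (a :: r)) (by simp)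
        (t := update (fun j => if j ∈ ks then a :: l else []) t r)
        (by rw [update_idem]; exact h₁) h₂).mono (n := (ks.length + 2) * (a :: r).length + 1)
        (by simp only [List.length_cons]; ring_nf; omega)
      convert h using 1
      funext j
      simp
  have h₁ := runs_pour h (update (fun _ => []) k w)
  have e : update (update (update (fun _ => []) k w) k []) t
      ((update (fun _ => []) k w k).reverse ++ update (fun _ => []) k w t) =
      update (fun j => if j ∈ ks then [] else []) t w.reverse := by
    rw [update_idem]
    funext j
    by_cases hj : j = t
    · subst hj; simp [h.symm]
    · by_cases hj' : j = k
      · subst hj'; simp [hj]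
      · simp [hj]
  rw [e] at h₁
  have h₂ := key w.reverse []
  simp only [List.reverse_reverse, List.append_nil, List.length_reverse] at h₂
  refine (h₁.seq h₂).mono ?_
  simp only [update_self]
  ring_nf
  omega

/-- Empties all stacks in a list. -/
def clearAll : List K → Cmd K A
  | [] => .skip
  | k :: ks => .seq (clear k) (clearAll ks)

theorem runs_clearAll (ks : List K) (s : K → List A) (b : ℕ) (hb : ∀ k, (s k).length ≤ b) :
    Runs (clearAll ks) s (fun k => if k ∈ ks then [] else s k) ((2 * b + 1) * ks.length + 1) := by
  induction ks generalizing s with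
  | nil => simpa [clearAll] using Runs.skip s
  | cons k ks ih =>
    have h := (runs_clear k s).seq (ih (update s k []) fun j => by
      by_cases hj : j = k
      · subst hj; simp
      · simpa [hj] using hb j)
    have h' := h.mono (n := (2 * b + 1) * (k :: ks).length + 1) (by
      have := hb k
      simp only [List.length_cons]
      ring_nf
      omega)
    rw [clearAll]
    convert h' using 1
    funext j
    by_cases hj : j = k
    · subst hj; simp
    · simp [hj]

/-- The stacks of the machine that hold the input word when the evaluation of formulas begins. -/
noncomputable def wordStacks [Fintype V] : List (Stk V M J) :=
  (Finset.univ : Finset V).toList.map Stk.right ++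
    (Finset.univ : Finset (Bool × Fin J)).toList.map fun i => Stk.dom i.1 i.2

omit [DecidableEq V] [DecidableEq M] in
theorem nodup_wordStacks [Fintype V] : (wordStacks : List (Stk V M J)).Nodup := by
  refine List.Nodup.append ?_ ?_ ?_
  · exact (Finset.nodup_toList _).map fun x y h => by simpa using h
  · exact (Finset.nodup_toList _).map fun x y h => by
      simpa [Prod.ext_iff] using h
  · intro k h₁ h₂
    simp only [List.mem_map] at h₁ h₂
    obtain ⟨x, -, rfl⟩ := h₁
    obtain ⟨y, -, h⟩ := h₂
    cases h

/-- A property of words that is expressed by a formula in inductively defined relations is decidable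
in polynomial time. -/
theorem polyTimeDecidable_of_indDefs {α : Type} [Fintype V] [Fintype M] (J : ℕ) [NeZero J]
    (enc : α → List Letter) (henc : ∀ a, enc a ≠ []) (ar : M → ℕ) (har : ∀ m, ar m ≤ J)
    (ds : List (IndDef V M)) (hds : ∀ d ∈ ds, d.WF ar) (θ : Fml V M) (hθ : θ.WF ar [])
    {P : α → Prop}
    (hP : ∀ a, P a ↔ θ.Holds (enc a) (valueAll (enc a) ds fun _ _ => False) fun _ => 0) :
    PolyTimeDecidable enc P := by
  obtain ⟨p, hp⟩ := exists_runs_resetAll (V := V) (J := J) ar har (Finset.univ : Finset M).toList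
  obtain ⟨q, hq⟩ := exists_runs_compileAll (J := J) ar har ds hds
  obtain ⟨r, hr⟩ := θ.exists_runs_compile (J := J) ar har [] hθ
  let ks : List (Stk V M J) := wordStacks
  let cs : List (Stk V M J) := (Finset.univ.erase Stk.bits).toList
  refine polyTimeDecidable_of_cmd
    (.seq (load .tmp .new ks) (.seq (resetAll ar (Finset.univ : Finset M).toList)
      (.seq (compileAll ds) (.seq θ.compile (clearAll cs))))) .tmp .bits Letter.bit
    (fun a b h => by simpa using h)
    (((ks.length + 4 : ℕ[X]) * X + 2) + (p + (q + (r +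
      ((2 * (X ^ J + X + 1) + 1) * (cs.length : ℕ[X]) + 1))))) fun a => ?_
  set w := enc a with hw
  have hw0 : w ≠ [] := henc a
  have hpos : 0 < w.length := List.length_pos_iff.2 hw0
  set R : M → List ℕ → Prop := valueAll w ds fun _ _ => False with hR
  have h₁ := runs_load (k := Stk.tmp) (t := Stk.new) (by simp) ks nodup_wordStacks
    (by simp [ks, wordStacks]) w
  have e₁ : (fun j => if j ∈ ks then w else []) = conf (V := V) w (fun _ => (w, [])) (fun _ => 0)
      (fun _ : M => []) [] [] := by
    funext k
    cases k <;> simp [conf, ks, wordStacks]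
  have h₂ := hp w (fun _ => (w, [])) (fun _ => 0) (fun _ => []) [] [] (fun _ => by simp)
  have e₂ : (fun m => if m ∈ (Finset.univ : Finset M).toList then
      table w.length (ar m) fun _ => False else []) = tables w ar fun _ _ => False := by
    funext m; simp [tables]
  rw [e₁] at h₁
  rw [e₂] at h₂
  have h₃ := hq w (fun _ _ => False) hw0
  have h₄ := hr w (fun _ => (w, [])) (fun _ => 0) R [] [] (fun _ => hpos) (fun _ _ => rfl)
  have h₅ := runs_clearAll cs (conf w (fun _ => (w, [])) (fun _ => 0) (tables w ar R)
    [truth (θ.Holds w R fun _ => 0)] []) (w.length ^ J + w.length + 1) (fun k => by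
      cases k with
      | rel m =>
        have := Nat.pow_le_pow_right hpos (har m)
        simp only [conf, tables, length_table]
        omega
      | dom b j => cases b <;> simp [conf] <;> omega
      | dtm b j => cases b <;> simp [conf]
      | right x => simp [conf]; omega
      | _ => simp [conf])
  have e₃ : (fun k => if k ∈ cs then [] else conf w (fun _ => (w, [])) (fun _ => 0)
      (tables w ar R) [truth (θ.Holds w R fun _ => 0)] [] k) =
      update (fun _ => []) .bits [truth (P a)] := by
    funext k
    by_cases hk : k = .bits
    · subst hk
      simp [cs, conf, hP a, hR, hw]
    · simp [cs, hk]
  rw [e₃] at h₅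
  refine (h₁.seq (h₂.seq (h₃.seq (h₄.seq h₅)))).mono ?_
  simp

namespace IndDef

variable (w : List Letter) (R : M → List ℕ → Prop) (d : IndDef V M)

theorem mem_tups_of_stages {k : ℕ} {l : List ℕ} (h : d.stages w R k l) :
    l ∈ tups w.length d.vars.length := by
  cases k with
  | zero => exact h.elim
  | succ k => exact h.1

theorem stages_succ {k : ℕ} {l : List ℕ} : d.stages w R (k + 1) l ↔
    l ∈ tups w.length d.vars.length ∧ (d.stages w R k l ∨
      d.body.Holds w (update R d.m (d.stages w R k)) (setEnv (fun _ => 0) d.vars l)) := by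
  rw [stages, stage, update_self]

theorem stages_le_succ {k : ℕ} {l : List ℕ} (h : d.stages w R k l) : d.stages w R (k + 1) l :=
  (d.stages_succ w R).2 ⟨d.mem_tups_of_stages w R h, .inl h⟩

/-- The stages become stationary after at most as many steps as there are tuples, since every
stage before that contains a new tuple. -/
theorem stages_card_succ :
    d.stages w R (w.length ^ d.vars.length + 1) = d.stages w R (w.length ^ d.vars.length) := by
  classical
  set n := w.length ^ d.vars.length with hn
  by_contra hne
  have hne' : ∀ k ≤ n, d.stages w R (k + 1) ≠ d.stages w R k := by
    intro k hk he
    have : ∀ j, d.stages w R (k + j) = d.stages w R k := by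
      intro j
      induction j with
      | zero => rfl
      | succ j ih =>
        have e : d.stages w R (k + (j + 1)) =
          stage w (update R d.m (d.stages w R (k + j))) d.m d.vars d.body := rfl
        rw [e, ih]
        exact he
    apply hne
    obtain ⟨j, hj⟩ := Nat.exists_eq_add_of_le hk
    rw [hj, add_assoc, this, this]
  let S : ℕ → Finset (List ℕ) := fun k =>
    (tups w.length d.vars.length).toFinset.filter (d.stages w R k)
  have hS : ∀ {k l}, l ∈ S k ↔ d.stages w R k l := by
    intro k l
    simp only [S, Finset.mem_filter, List.mem_toFinset, and_iff_right_iff_imp]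
    exact d.mem_tups_of_stages w R
  have hcard : ∀ k ≤ n + 1, k ≤ (S k).card := by
    intro k
    induction k with
    | zero => simp
    | succ k ih =>
      intro hk
      have hlt : S k ⊂ S (k + 1) := by
        refine Finset.ssubset_iff_subset_ne.2 ⟨fun l h => hS.2 (d.stages_le_succ w R (hS.1 h)),
          fun he => hne' k (by omega) ?_⟩
        funext l
        exact propext (by rw [← hS, ← hS, he])
      exact (ih (by omega)).trans_lt (Finset.card_lt_card hlt)
  have h₁ := hcard (n + 1) le_rfl
  have h₂ : (S (n + 1)).card ≤ n := by
    refine (Finset.card_filter_le _ _).trans ((List.toFinset_card_le _).trans ?_)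
    rw [length_tups]
  omega

/-- An inductively defined relation is `T` if the definition does not lead out of `T`, and if `T` is
contained in all relations that are closed under the definition. The body need not be positive in
`m`. -/
theorem value_iff (T : List ℕ → Prop)
    (hT : ∀ X : List ℕ → Prop, (∀ l, X l → T l) → ∀ l ∈ tups w.length d.vars.length,
      d.body.Holds w (update R d.m X) (setEnv (fun _ => 0) d.vars l) → T l)
    (hmin : ∀ X : List ℕ → Prop, (∀ l ∈ tups w.length d.vars.length,
      d.body.Holds w (update R d.m X) (setEnv (fun _ => 0) d.vars l) → X l) →
      ∀ l ∈ tups w.length d.vars.length, T l → X l)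
    {l : List ℕ} (hl : l ∈ tups w.length d.vars.length) : d.value w R l ↔ T l := by
  constructor
  · have : ∀ k l, d.stages w R k l → T l := by
      intro k
      induction k with
      | zero => exact fun _ h => h.elim
      | succ k ih =>
        intro l h
        obtain ⟨hl, h | h⟩ := (d.stages_succ w R).1 h
        · exact ih l h
        · exact hT _ ih l hl h
    exact this _ l
  · refine hmin _ (fun l hl h => ?_) l hl
    rw [value, ← stages_card_succ]
    exact (d.stages_succ w R).2 ⟨hl, .inr h⟩

end IndDef

end StackProgram

namespace TreeAutomata

open Function StackProgram

/-! ### Consistent rules and pairs of states that can be merged -/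

namespace DFTA

variable {F : Signature} {Q X Y : Type} (A : DFTA F Q)

/-- The state that the automaton assigns to a term, when it assigns `σ x` to the variable `x`. -/
def termState (A : DFTA F Q) (σ : X → Q) : Term F X → Q
  | .var x => σ x
  | .app f ts => A.δ f fun i => A.termState σ (ts i)

theorem termState_subst (σ : Y → Q) (τ : X → Term F Y) (t : Term F X) :
    A.termState σ (t.subst τ) = A.termState (fun x => A.termState σ (τ x)) t := by
  induction t with
  | var x => rfl
  | app f ts ih => simp [termState, Term.subst, ih]

theorem termState_ofTree (σ : X → Q) (t : Tree F) : A.termState σ (Term.ofTree t) = A.eval t := by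
  induction t with
  | var x => exact x.elim
  | app f ts ih =>
    simp only [Term.ofTree] at ih
    simp [termState, Term.ofTree, Term.subst, eval, ih]

/-- A state is reachable if it is the state of some tree. -/
def Reachable (q : Q) : Prop := ∃ t : Tree F, A.eval t = q

theorem Reachable.δ {A : DFTA F Q} {f : F.Sym} {v : Fin (F.arity f) → Q}
    (h : ∀ i, A.Reachable (v i)) : A.Reachable (A.δ f v) := by
  choose ts hts using h
  exact ⟨.app f ts, by simp [eval, hts]⟩

theorem exists_reachable : ∃ q, A.Reachable q := by
  obtain ⟨c, hc⟩ := F.exists_const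
  have : IsEmpty (Fin (F.arity c)) := by rw [hc]; infer_instance
  exact ⟨_, .app c this.elim, rfl⟩

/-- The maps on the states that are induced by contexts. -/
inductive Trans : (Q → Q) → Prop
  | id : Trans id
  | step {g : Q → Q} (f : F.Sym) (v : Fin (F.arity f) → Q) (i : Fin (F.arity f))
      (hv : ∀ j ≠ i, A.Reachable (v j)) (hg : Trans g) : Trans fun q => A.δ f (update v i (g q))

variable {A}

theorem Trans.comp {g h : Q → Q} (hh : A.Trans h) (hg : A.Trans g) : A.Trans (h ∘ g) := by
  induction hh with
  | id => exact hg
  | step f v i hv _ ih => exact .step f v i hv ih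

theorem Trans.reachable {g : Q → Q} (hg : A.Trans g) {q : Q} (hq : A.Reachable q) :
    A.Reachable (g q) := by
  induction hg with
  | id => exact hq
  | step f v i hv _ ih =>
    refine Reachable.δ fun j => ?_
    by_cases h : j = i
    · subst h; simpa using ih
    · simpa [h] using hv j h

theorem _root_.TreeAutomata.Term.exists_ofTree {t : Term F X} (ht : t.numVarOcc = 0) :
    ∃ s : Tree F, t = Term.ofTree s := by
  induction t with
  | var x => simp [Term.numVarOcc] at ht
  | app f ts ih =>
    simp only [Term.numVarOcc, Finset.sum_eq_zero_iff, Finset.mem_univ, true_implies] at ht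
    choose s hs using fun i => ih i (ht i)
    exact ⟨.app f s, by simp only [Term.ofTree, Term.subst] at hs ⊢; simp [← hs]⟩

variable (A)

theorem _root_.TreeAutomata.Term.subst_ofTree (τ : X → Term F Y) (t : Tree F) :
    (Term.ofTree t : Term F X).subst τ = Term.ofTree t := by
  induction t with
  | var x => exact x.elim
  | app f ts ih =>
    simp only [Term.ofTree] at ih
    simp [Term.ofTree, Term.subst, ih]

theorem _root_.TreeAutomata.Term.subst_subst {Z : Type} (σ : X → Term F Y) (τ : Y → Term F Z)
    (t : Term F X) : (t.subst σ).subst τ = t.subst fun x => (σ x).subst τ := by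
  induction t with
  | var x => rfl
  | app f ts ih => simp [Term.subst, ih]

theorem exists_eq_one_of_sum_eq_one {ι : Type} [Fintype ι] {n : ι → ℕ} (h : ∑ i, n i = 1) :
    ∃ i, n i = 1 ∧ ∀ j ≠ i, n j = 0 := by
  classical
  obtain ⟨i, -, hi⟩ : ∃ i ∈ Finset.univ, n i ≠ 0 := Finset.exists_ne_zero_of_sum_ne_zero (by omega)
  have h' := Finset.add_sum_erase Finset.univ n (Finset.mem_univ i)
  have h0 : ∑ j ∈ Finset.univ.erase i, n j = 0 := by omega
  exact ⟨i, by omega, fun j hj => Finset.sum_eq_zero_iff.1 h0 j (by simpa using hj)⟩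

/-- A context has one variable, and induces a map on the states. -/
theorem exists_trans_of_isContext {l : Term F X} (hl : l.IsContext) :
    ∃ x g, A.Trans g ∧ (∀ σ, A.termState σ l = g (σ x)) ∧
      ∀ τ τ' : X → Term F Y, τ x = τ' x → l.subst τ = l.subst τ' := by
  induction l with
  | var x => exact ⟨x, id, .id, fun _ => rfl, fun _ _ h => h⟩
  | app f ts ih =>
    simp only [Term.IsContext, Term.numVarOcc] at hl
    obtain ⟨i, hi, h0⟩ := exists_eq_one_of_sum_eq_one hl
    obtain ⟨x, g, hg, e, hτ⟩ := ih i hi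
    choose s hs using fun j (hj : j ≠ i) => Term.exists_ofTree (h0 j hj)
    let v : Fin (F.arity f) → Q := fun j =>
      if hj : j = i then A.exists_reachable.choose else A.eval (s j hj)
    refine ⟨x, _, .step f v i (fun j hj => ⟨s j hj, by simp [v, hj]⟩) hg, fun σ => ?_,
      fun τ τ' h => ?_⟩
    · simp only [termState]
      congr 1
      funext j
      by_cases hj : j = i
      · subst hj; simp [e]
      · simp only [ne_eq, hj, not_false_eq_true, update_of_ne, v, dite_false]
        conv_lhs => rw [hs j hj]
        exact A.termState_ofTree σ _
    · simp only [Term.subst]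
      congr 1
      funext j
      by_cases hj : j = i
      · subst hj; exact hτ τ τ' h
      · rw [hs j hj, Term.subst_ofTree, Term.subst_ofTree]

theorem numVarOcc_ofTree (t : Tree F) : (Term.ofTree t : Term F X).numVarOcc = 0 := by
  induction t with
  | var x => exact x.elim
  | app f ts ih =>
    simp only [Term.ofTree] at ih
    simp [Term.ofTree, Term.subst, Term.numVarOcc, ih]

variable {A} in
theorem Trans.exists_context {g : Q → Q} (hg : A.Trans g) (x : X) :
    ∃ l : Term F X, l.IsContext ∧ ∀ σ, A.termState σ l = g (σ x) := by
  induction hg with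
  | id => exact ⟨.var x, rfl, fun _ => rfl⟩
  | @step g f v i hv _ ih =>
    obtain ⟨l, hl, e⟩ := ih
    choose s hs using hv
    refine ⟨.app f fun j => if hj : j = i then l else Term.ofTree (s j hj), ?_, fun σ => ?_⟩
    · simp only [Term.IsContext, Term.numVarOcc]
      rw [Finset.sum_eq_single i (fun j _ hj => by simp [hj, numVarOcc_ofTree])
        (fun h => absurd (Finset.mem_univ i) h)]
      simpa using show l.numVarOcc = 1 from hl
    · simp only [termState]
      congr 1
      funext j
      by_cases hj : j = i
      · subst hj; simp [e]
      · simp [hj, termState_ofTree, hs]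

/-- Two states are equivalent if no context distinguishes them. -/
def StateEquiv (p q : Q) : Prop := ∀ h, A.Trans h → (h p ∈ A.acc ↔ h q ∈ A.acc)

/-- A rewrite step between trees can be carried out inside a context. -/
theorem step_context {R : TRS F X} {s t : Tree F}
    (hst : Step R (Term.ofTree s) (Term.ofTree t)) {h : Q → Q} (hh : A.Trans h) :
    ∃ s' t' : Tree F, Step R (Term.ofTree s' : Term F X) (Term.ofTree t') ∧
      A.eval s' = h (A.eval s) ∧ A.eval t' = h (A.eval t) := by
  induction hh with
  | id => exact ⟨s, t, hst, rfl, rfl⟩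
  | @step g f v i hv _ ih =>
    obtain ⟨s', t', hst', hs', ht'⟩ := ih
    choose u hu using hv
    let c : Tree F → Fin (F.arity f) → Tree F := fun z j => if hj : j = i then z else u j hj
    have hc : ∀ z, A.eval (.app f (c z)) = A.δ f (update v i (A.eval z)) := by
      intro z
      simp only [eval]
      congr 1
      funext j
      by_cases hj : j = i
      · subst hj; simp [c]
      · simp [c, hj, hu]
    refine ⟨.app f (c s'), .app f (c t'), ?_, by rw [hc, hs'], by rw [hc, ht']⟩
    have := Step.congr (R := R) f (fun j => (Term.ofTree (c s' j) : Term F X)) i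
      (t := Term.ofTree t') (by simpa [c] using hst')
    have e : (fun j => (Term.ofTree (c t' j) : Term F X)) =
        update (fun j => Term.ofTree (c s' j)) i (Term.ofTree t') := by
      funext j
      by_cases hj : j = i
      · subst hj; simp [c]
      · simp [c, hj]
    rw [← e] at this
    exact this

theorem termState_reachable {σ : X → Q} (hσ : ∀ x, A.Reachable (σ x)) (t : Term F X) :
    A.Reachable (A.termState σ t) := by
  induction t with
  | var x => exact hσ x
  | app f ts ih => exact Reachable.δ ih

/-- A rewrite step that begins at a tree ends at a tree, and it takes place in a context with map
`h`, where it replaces an instance of `l`, whose state is `g p`, by `r`. -/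
theorem step_singleton {l : Term F X} {r : Tree F} {g : Q → Q} {x : X}
    (hl : ∀ σ, A.termState σ l = g (σ x)) {s t : Term F X} (hst : Step {(l, Term.ofTree r)} s t)
    {s' : Tree F} (hs : s = Term.ofTree s') :
    ∃ t' : Tree F, t = Term.ofTree t' ∧ ∃ h p, A.Trans h ∧ A.Reachable p ∧
      A.eval s' = h (g p) ∧ A.eval t' = h (A.eval r) := by
  induction hst generalizing s' with
  | rule hlr σ _ =>
    simp only [Finset.mem_singleton, Prod.mk.injEq] at hlr
    obtain ⟨rfl, rfl⟩ := hlr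
    obtain ⟨q₀, hq₀⟩ := A.exists_reachable
    refine ⟨r, ?_, id, A.termState (fun _ => q₀) (σ x), .id, A.termState_reachable (fun _ => hq₀) _,
      ?_, rfl⟩
    · exact Term.subst_ofTree σ r
    · rw [← A.termState_ofTree (fun _ => q₀), ← hs, termState_subst, hl]
      rfl
  | congr f ts i h ih =>
    cases s' with
    | var x => exact x.elim
    | app f' ss =>
      simp only [Term.ofTree, Term.subst, Term.app.injEq] at hs
      obtain ⟨rfl, hs⟩ := hs
      have hs := fun j => congrFun (eq_of_heq hs) j
      obtain ⟨t', rfl, h, p, hh, hp, e₁, e₂⟩ := ih (hs i)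
      refine ⟨.app f (update ss i t'), ?_, _, p, .step f (fun j => A.eval (ss j)) i
        (fun j _ => ⟨_, rfl⟩) hh, hp, ?_, ?_⟩
      · simp only [Term.ofTree, Term.subst]
        congr 1
        funext j
        by_cases hj : j = i
        · subst hj; simp
        · simp [hj, hs]
      · rw [← e₁]
        simp only [eval]
        congr 1
        funext j
        by_cases hj : j = i
        · subst hj; simp
        · simp [hj]
      · rw [← e₂]
        simp only [eval]
        congr 1
        funext j
        by_cases hj : j = i
        · subst hj; simp
        · simp [hj]

/-- A rule whose left side is a context and whose right side is a tree is consistent if and only if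
the context maps all reachable states to states that are equivalent to that of the right side. -/
theorem consistent_iff {l : Term F X} {r : Tree F} {g : Q → Q} {x : X}
    (hl : ∀ σ, A.termState σ l = g (σ x))
    (hx : ∀ τ τ' : X → Term F X, τ x = τ' x → l.subst τ = l.subst τ') :
    Consistent {(l, Term.ofTree r)} A.language ↔
      ∀ p, A.Reachable p → A.StateEquiv (g p) (A.eval r) := by
  classical
  constructor
  · rintro hc p ⟨u, rfl⟩ h hh
    let c : Tree F := l.subst fun _ => u
    have hc' : l.subst (update Term.var x (Term.ofTree u)) = (Term.ofTree c : Term F X) := by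
      rw [hx _ (fun _ => Term.ofTree u) (by simp)]
      exact (Term.subst_subst _ _ _).symm
    have hst : Step {(l, Term.ofTree r)} (Term.ofTree c) (Term.ofTree r : Term F X) := by
      have := Step.rule (R := {(l, Term.ofTree r)})
        (Finset.mem_singleton_self (l, Term.ofTree r)) (update Term.var x (Term.ofTree u))
        ((Set.finite_singleton x).subset fun y hy => by
          by_contra hyx
          simp only [Set.mem_singleton_iff] at hyx
          simp [hyx] at hy)
      rwa [hc', Term.subst_ofTree] at this
    obtain ⟨s', t', hst', hs', ht'⟩ := A.step_context hst hh
    have := hc s' t' (.single hst')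
    have e : A.eval c = g (A.eval u) := by
      obtain ⟨q₀, -⟩ := A.exists_reachable
      rw [← A.termState_ofTree (fun _ : X => q₀), ← hc', termState_subst, hl]
      simp [termState_ofTree]
    simpa [language, hs', ht', e] using this
  · intro H s t hst
    have key : ∀ t' : Term F X, Rewrites {(l, Term.ofTree r)} (Term.ofTree s) t' →
        ∃ t'' : Tree F, t' = Term.ofTree t'' ∧ (s ∈ A.language ↔ t'' ∈ A.language) := by
      intro t' h
      induction h with
      | refl => exact ⟨s, rfl, Iff.rfl⟩
      | tail _ h ih =>
        obtain ⟨u, rfl, hu⟩ := ih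
        obtain ⟨v, rfl, k, p, hk, hp, e₁, e₂⟩ := A.step_singleton hl h rfl
        refine ⟨v, rfl, hu.trans ?_⟩
        simp only [language, Set.mem_ofPred_eq, e₁, e₂]
        exact H p hp k hk
    obtain ⟨t', ht', h⟩ := key _ hst
    rw [h]
    have : A.eval t = A.eval t' := by
      obtain ⟨q₀, -⟩ := A.exists_reachable
      rw [← A.termState_ofTree (fun _ : X => q₀), ht', termState_ofTree]
    simp [language, this]

/-- One step of two copies of the automaton in a common context: a pair of states is replaced by
the states that the automaton reaches from it when it reads a symbol, with the same reachable states
at all other arguments of the symbol. -/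
def Link (x y : Q × Q) : Prop :=
  ∃ (f : F.Sym) (v : Fin (F.arity f) → Q) (i : Fin (F.arity f)), (∀ j ≠ i, A.Reachable (v j)) ∧
    y = (A.δ f (update v i x.1), A.δ f (update v i x.2))

theorem links_iff {x y : Q × Q} :
    Relation.ReflTransGen A.Link x y ↔ ∃ g, A.Trans g ∧ y = (g x.1, g x.2) := by
  constructor
  · intro h
    induction h with
    | refl => exact ⟨id, .id, rfl⟩
    | tail _ h ih =>
      obtain ⟨g, hg, rfl⟩ := ih
      obtain ⟨f, v, i, hv, rfl⟩ := h
      exact ⟨_, .step f v i hv hg, rfl⟩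
  · rintro ⟨g, hg, rfl⟩
    induction hg with
    | id => exact .refl
    | step f v i hv _ ih => exact ih.tail ⟨f, v, i, hv, rfl⟩

/-- A context distinguishes the two states of the pair. -/
def Distinct (x : Q × Q) : Prop :=
  ∃ y, Relation.ReflTransGen A.Link x y ∧ ¬ (y.1 ∈ A.acc ↔ y.2 ∈ A.acc)

/-- A context maps the two states of the pair to equivalent states. -/
def Mergeable (x : Q × Q) : Prop :=
  ∃ y, Relation.ReflTransGen A.Link x y ∧ ¬ A.Distinct y

theorem not_distinct_iff {p q : Q} : ¬ A.Distinct (p, q) ↔ A.StateEquiv p q := by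
  simp only [Distinct, links_iff, StateEquiv]
  push Not
  constructor
  · intro h g hg
    exact h _ ⟨g, hg, rfl⟩
  · rintro h _ ⟨g, hg, rfl⟩
    exact h g hg

theorem mergeable_iff {p q : Q} :
    A.Mergeable (p, q) ↔ ∃ g, A.Trans g ∧ A.StateEquiv (g p) (g q) := by
  simp only [Mergeable, links_iff]
  constructor
  · rintro ⟨_, ⟨g, hg, rfl⟩, h⟩
    exact ⟨g, hg, A.not_distinct_iff.1 h⟩
  · rintro ⟨g, hg, h⟩
    exact ⟨_, ⟨g, hg, rfl⟩, A.not_distinct_iff.2 h⟩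

variable {A} in
theorem StateEquiv.map {p q : Q} (h : A.StateEquiv p q) {g : Q → Q} (hg : A.Trans g) :
    A.StateEquiv (g p) (g q) := fun k hk => h (k ∘ g) (hk.comp hg)

/-- If all pairs of reachable states can be merged, then contexts that merge pairs can be composed
to a context that merges all reachable states. -/
theorem exists_trans_stateEquiv [Finite Q]
    (H : ∀ p q, A.Reachable p → A.Reachable q → A.Mergeable (p, q)) :
    ∃ g, A.Trans g ∧ ∀ p q, A.Reachable p → A.Reachable q → A.StateEquiv (g p) (g q) := by
  classical
  have := Fintype.ofFinite Q
  have key : ∀ S : Finset Q, (∀ q ∈ S, A.Reachable q) →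
      ∃ g, A.Trans g ∧ ∀ p ∈ S, ∀ q ∈ S, A.StateEquiv (g p) (g q) := by
    intro S
    induction S using Finset.induction_on with
    | empty => exact fun _ => ⟨id, .id, by simp⟩
    | insert a S _ ih =>
      intro hS
      obtain ⟨g, hg, h⟩ := ih fun q hq => hS q (Finset.mem_insert_of_mem hq)
      rcases S.eq_empty_or_nonempty with rfl | ⟨b, hb⟩
      · exact ⟨id, .id, by simp [StateEquiv]⟩
      obtain ⟨k, hk, e⟩ := A.mergeable_iff.1 (H (g a) (g b)
        (hg.reachable (hS a (Finset.mem_insert_self a S)))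
        (hg.reachable (hS b (Finset.mem_insert_of_mem hb))))
      have hab : ∀ p ∈ insert a S, A.StateEquiv (k (g p)) (k (g b)) := by
        intro p hp
        rcases Finset.mem_insert.1 hp with rfl | hp
        · exact e
        · exact (h p hp b hb).map hk
      exact ⟨k ∘ g, hk.comp hg, fun p hp q hq f hf =>
        (hab p hp f hf).trans (hab q hq f hf).symm⟩
  obtain ⟨g, hg, h⟩ := key (Finset.univ.filter A.Reachable) (by simp)
  exact ⟨g, hg, fun p q hp hq => h p (by simpa using hp) q (by simpa using hq)⟩

theorem exists_consistent_rule_iff [Finite Q] [Nonempty X] :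
    (∃ (l : Term F X) (r : Tree F), l.IsContext ∧ Consistent {(l, Term.ofTree r)} A.language) ↔
      ∀ p q, A.Reachable p → A.Reachable q → A.Mergeable (p, q) := by
  constructor
  · rintro ⟨l, r, hl, hc⟩ p q hp hq
    obtain ⟨x, g, hg, e, hx⟩ := A.exists_trans_of_isContext (Y := X) hl
    have h := (A.consistent_iff e hx).1 hc
    exact A.mergeable_iff.2 ⟨g, hg, fun k hk => (h p hp k hk).trans (h q hq k hk).symm⟩
  · intro H
    obtain ⟨g, hg, h⟩ := A.exists_trans_stateEquiv H
    obtain ⟨l, hl, e⟩ := hg.exists_context (Classical.arbitrary X)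
    obtain ⟨q₀, hq₀⟩ := A.exists_reachable
    obtain ⟨r, hr⟩ := hg.reachable hq₀
    obtain ⟨x', g', -, e', hx⟩ := A.exists_trans_of_isContext (Y := X) hl
    refine ⟨l, r, hl, (A.consistent_iff e' hx).2 fun p hp => ?_⟩
    have : g' p = g p := (e' fun _ => p).symm.trans (e fun _ => p)
    rw [this, hr]
    exact h p q₀ hp hq₀

end DFTA

/-! ### Automata as words -/

/-- Whether a letter is a binary digit. -/
def isBit : Letter → Bool
  | .bit _ => true
  | _ => false

/-- The word of a list of tokens; a token consists of a letter and a number, written in binary. -/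
def encTokens (T : List (Letter × ℕ)) : List Letter := T.flatMap fun t => t.1 :: binary t.2

theorem encTokens_cons (t : Letter × ℕ) (T : List (Letter × ℕ)) :
    encTokens (t :: T) = t.1 :: (binary t.2 ++ encTokens T) := rfl

theorem encTokens_append (S T : List (Letter × ℕ)) :
    encTokens (S ++ T) = encTokens S ++ encTokens T := List.flatMap_append

theorem binary_injective : Injective binary := by
  intro m n h
  have h' : Computability.encodeNat m = Computability.encodeNat n :=
    List.map_injective_iff.2 (fun a b h => by simpa using h) h
  rw [← Computability.decode_encodeNat m, h', Computability.decode_encodeNat]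

theorem binary_inj {m n : ℕ} : binary m = binary n ↔ m = n := binary_injective.eq_iff

theorem isBit_of_mem_binary {n : ℕ} {a : Letter} (h : a ∈ binary n) : isBit a = true := by
  simp only [binary, List.mem_map] at h
  obtain ⟨b, -, rfl⟩ := h
  rfl

/-- The binary digits that follow the position `d`. -/
def digits (w : List Letter) (d : ℕ) : List Letter := (w.drop (d + 1)).takeWhile isBit

theorem digits_eq (w : List Letter) (d : ℕ) : digits w d =
    if ∃ a, w[d + 1]? = some a ∧ isBit a = true then w.getD (d + 1) .sep :: digits w (d + 1)
      else [] := by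
  unfold digits
  by_cases h : d + 1 < w.length
  · rw [List.drop_eq_getElem_cons h, List.takeWhile_cons]
    simp [h]
  · simp [h, List.drop_eq_nil_of_le (Nat.le_of_not_lt h)]

/-- A list of tokens is separated if the numbers can be told apart in its word, that is, if the
letters of its tokens are not digits. -/
def Separated (T : List (Letter × ℕ)) : Prop := ∀ t ∈ T, isBit t.1 = false

/-- At the position `d` of the word of `T`, the word of the tokens `S` begins. -/
def At (T : List (Letter × ℕ)) (d : ℕ) (S : List (Letter × ℕ)) : Prop :=
  d < (encTokens T).length ∧ (encTokens T).drop d = encTokens S ∧ S <:+ T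

section At

variable {T S S' : List (Letter × ℕ)} {d e n : ℕ} {a : Letter}

theorem digits_drop (w : List Letter) (d : ℕ) : digits w d = digits (w.drop d) 0 := by
  simp [digits, List.drop_drop]

theorem takeWhile_digits (hT : Separated T) (n : ℕ) :
    (binary n ++ encTokens T).takeWhile isBit = binary n := by
  rw [List.takeWhile_append_of_pos fun a h => isBit_of_mem_binary h]
  cases T with
  | nil => simp [encTokens]
  | cons t T => simp [encTokens_cons, hT t (by simp)]

theorem Separated.of_suffix (hT : Separated T) (h : S <:+ T) : Separated S :=
  fun t ht => hT t (h.subset ht)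

theorem At.digits_eq (hT : Separated T) (h : At T d ((a, n) :: S)) :
    digits (encTokens T) d = binary n := by
  rw [digits_drop, h.2.1]
  exact takeWhile_digits (hT.of_suffix ((List.suffix_cons _ _).trans h.2.2)) n

theorem At.getElem? (h : At T d ((a, n) :: S)) : (encTokens T)[d]? = some a := by
  have := congrArg (·[0]?) h.2.1
  simpa [encTokens_cons] using this

theorem At.isBit_eq (hT : Separated T) (h : At T d ((a, n) :: S)) : isBit a = false :=
  hT (a, n) (h.2.2.subset (by simp))

/-- Every letter that is not a digit begins a token. -/
theorem exists_at_of_getElem? (h : (encTokens T)[d]? = some a)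
    (ha : isBit a = false) : ∃ n S, At T d ((a, n) :: S) := by
  have hd := (List.getElem?_eq_some_iff.1 h).1
  suffices ∃ n S, (encTokens T).drop d = encTokens ((a, n) :: S) ∧ (a, n) :: S <:+ T by
    obtain ⟨n, S, h⟩ := this
    exact ⟨n, S, hd, h⟩
  clear hd
  induction T generalizing d with
  | nil => simp [encTokens] at h
  | cons t T ih =>
    cases d with
    | zero =>
      simp only [encTokens_cons, List.getElem?_cons_zero, Option.some.injEq] at h
      subst h
      exact ⟨t.2, T, by simp, List.suffix_rfl⟩
    | succ d =>
      simp only [encTokens_cons, List.getElem?_cons_succ] at h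
      by_cases hd : d < (binary t.2).length
      · rw [List.getElem?_append_left hd] at h
        rw [isBit_of_mem_binary (List.mem_of_getElem? h)] at ha
        simp at ha
      · rw [List.getElem?_append_right (by omega)] at h
        obtain ⟨n, S, h₁, h₂⟩ := ih h
        refine ⟨n, S, ?_, h₂.trans (List.suffix_cons _ _)⟩
        rw [encTokens_cons, List.drop_succ_cons, List.drop_append,
          List.drop_eq_nil_of_le (by omega), List.nil_append, h₁]

theorem exists_at (h : S <:+ T) (hS : S ≠ []) : ∃ d, At T d S := by
  obtain ⟨P, rfl⟩ := h
  obtain ⟨t, S, rfl⟩ := List.exists_cons_of_ne_nil hS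
  refine ⟨(encTokens P).length, ?_, ?_, List.suffix_append _ _⟩
  · simp [encTokens_append, encTokens_cons]
  · simp [encTokens_append]

theorem eq_of_suffix_of_length_eq (h : S <:+ S')
    (e : (encTokens S).length = (encTokens S').length) : S = S' := by
  obtain ⟨P, rfl⟩ := h
  cases P with
  | nil => rfl
  | cons t P =>
    simp only [encTokens_append, encTokens_cons, List.length_append, List.length_cons] at e
    omega

theorem At.eq (h : At T d S) (h' : At T d S') : S = S' := by
  have e : (encTokens S).length = (encTokens S').length := by rw [← h.2.1, h'.2.1]
  rcases List.suffix_or_suffix_of_suffix h.2.2 h'.2.2 with hs | hs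
  · exact eq_of_suffix_of_length_eq hs e
  · exact (eq_of_suffix_of_length_eq hs e.symm).symm

theorem At.pos_eq (h : At T d S) (h' : At T e S) : d = e := by
  have := congrArg List.length (h.2.1.trans h'.2.1.symm)
  have h₁ := h.1
  have h₂ := h'.1
  simp only [List.length_drop] at this
  omega

/-- The position `e` is the first position after `d` that carries no digit. -/
def IsNext (w : List Letter) (d e : ℕ) : Prop :=
  d < e ∧ (∃ a, w[e]? = some a ∧ isBit a = false) ∧
    ∀ z, d < z → z < e → ∃ a, w[z]? = some a ∧ isBit a = true

theorem At.isNext_iff (hT : Separated T) (h : At T d ((a, n) :: S)) :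
    IsNext (encTokens T) d e ↔ At T e S := by
  set e₀ := d + (1 + (binary n).length) with he₀
  have hdrop := h.2.1
  rw [encTokens_cons] at hdrop
  have hlen : (encTokens T).length = e₀ + (encTokens S).length := by
    have h₁ := congrArg List.length hdrop
    have h₂ := h.1
    simp only [List.length_drop, List.length_cons, List.length_append] at h₁
    omega
  have hbit : ∀ z, d < z → z < e₀ → ∃ b, (encTokens T)[z]? = some b ∧ isBit b = true := by
    intro z hz hz'
    obtain ⟨i, rfl⟩ := Nat.exists_eq_add_of_lt hz
    have hi : i < (binary n).length := by omega
    refine ⟨(binary n)[i], ?_, isBit_of_mem_binary (List.getElem_mem hi)⟩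
    have := congrArg (·[i + 1]?) hdrop
    simp only [List.getElem?_drop, List.getElem?_cons_succ, List.getElem?_append_left hi,
      List.getElem?_eq_getElem hi] at this
    rw [← this]
    rfl
  have hdrop₀ : (encTokens T).drop e₀ = encTokens S := by
    rw [he₀, ← List.drop_drop, hdrop, add_comm 1, List.drop_succ_cons, List.drop_left]
  have hat : S ≠ [] → At T e₀ S := by
    intro hS
    refine ⟨?_, hdrop₀, (List.suffix_cons _ _).trans h.2.2⟩
    obtain ⟨t, S, rfl⟩ := List.exists_cons_of_ne_nil hS
    rw [hlen, encTokens_cons]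
    simp
  constructor
  · rintro ⟨hde, ⟨b, hb, hb'⟩, hbits⟩
    have he : e₀ ≤ e := by
      by_contra hlt
      obtain ⟨c, hc, hc'⟩ := hbit e hde (by omega)
      simp_all
    have hS : S ≠ [] := by
      rintro rfl
      have := (List.getElem?_eq_some_iff.1 hb).1
      rw [hlen, show (encTokens []).length = 0 from rfl] at this
      omega
    have hat := hat hS
    rcases he.eq_or_lt with rfl | hlt
    · exact hat
    · obtain ⟨t, S, rfl⟩ := List.exists_cons_of_ne_nil hS
      obtain ⟨c, hc, hc'⟩ := hbits e₀ (by omega) hlt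
      have h₁ := hat.getElem?
      have h₂ := hat.isBit_eq hT
      simp_all
  · intro he
    have hS : S ≠ [] := by
      rintro rfl
      have h₁ := he.2.1
      have h₂ := he.1
      have := congrArg List.length h₁
      simp only [List.length_drop] at this
      simp only [encTokens, List.flatMap_nil, List.length_nil] at this h₂
      omega
    obtain rfl := he.pos_eq (hat hS)
    obtain ⟨t, S, rfl⟩ := List.exists_cons_of_ne_nil hS
    exact ⟨by omega, ⟨t.1, he.getElem?, he.isBit_eq hT⟩, hbit⟩

theorem At.exists_next (h : At T d ((a, n) :: S)) (hS : S ≠ []) : ∃ e, At T e S :=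
  exists_at ((List.suffix_cons _ _).trans h.2.2) hS

end At

/-- A token in the word of a concatenation of blocks lies in one of the blocks. -/
theorem exists_of_suffix_flatMap {β τ : Type} {l : List β} {g : β → List τ} {t : τ} {S : List τ}
    (h : t :: S <:+ l.flatMap g) : ∃ b ∈ l, ∃ P P' R, g b = P ++ t :: P' ∧ S = P' ++ R := by
  induction l with
  | nil => simp at h
  | cons b l ih =>
    rw [List.flatMap_cons] at h
    obtain ⟨P, hP⟩ := h
    rcases List.append_eq_append_iff.1 hP with ⟨Q, h₁, h₂⟩ | ⟨Q, h₁, h₂⟩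
    · cases Q with
      | nil =>
        rw [List.nil_append] at h₂
        obtain ⟨b', hb', h⟩ := ih ⟨[], h₂⟩
        exact ⟨b', by simp [hb'], h⟩
      | cons u Q =>
        rw [List.cons_append, List.cons.injEq] at h₂
        obtain ⟨rfl, rfl⟩ := h₂
        exact ⟨b, by simp, P, Q, _, h₁, rfl⟩
    · obtain ⟨b', hb', h⟩ := ih ⟨Q, h₂.symm⟩
      exact ⟨b', by simp [hb'], h⟩

theorem exists_suffix_flatMap {β τ : Type} {l : List β} (g : β → List τ) {b : β} (hb : b ∈ l) :
    ∃ R, g b ++ R <:+ l.flatMap g := by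
  obtain ⟨l₁, l₂, rfl⟩ := List.append_of_mem hb
  exact ⟨l₂.flatMap g, l₁.flatMap g, by simp⟩

namespace DFTAInput

variable (A : DFTAInput)

/-- The tokens of the list of symbols. -/
def symTokens : List (Letter × ℕ) :=
  (List.finRange A.numSyms).flatMap fun f => [(.sym, f.val), (.sep, A.arity f)]

/-- The tokens that describe the state `q`. -/
def stateBlock (q : Fin A.numStates) : List (Letter × ℕ) :=
  [(.state, q.val), (if q ∈ A.aut.acc then .accept else .reject, 0)]

/-- The tokens of a row of the transition table after the first one: the arguments `v`, and the
result `r`. -/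
def rowTail {k : ℕ} (v : Fin k → ℕ) (r : ℕ) : List (Letter × ℕ) :=
  (List.ofFn v).map (fun q => (.sep, q)) ++ [(.to, r)]

/-- The tokens of a row of the transition table. -/
def rowBlock (f : Fin A.numSyms) (v : Fin (A.arity f) → Fin A.numStates) : List (Letter × ℕ) :=
  (.trans, f.val) :: rowTail (fun i => (v i).val) (A.aut.δ f v)

/-- The tokens of the word that represents an automaton. -/
def tokens : List (Letter × ℕ) :=
  A.symTokens ++ (List.finRange A.numStates).flatMap A.stateBlock ++
    (List.finRange A.numSyms).flatMap fun f =>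
      (tuples A.numStates (A.arity f)).flatMap (A.rowBlock f)

theorem encode_eq : A.encode = encTokens A.tokens := by
  have h0 : binary 0 = [] := rfl
  simp only [encode, tokens, encTokens_append]
  congr 1
  · congr 1
    · simp [encodeSyms, symTokens, encTokens, List.flatMap_assoc]
    · simp [encodeStates, stateBlock, encTokens, List.flatMap_assoc, h0]
  · simp [encodeTrans, rowBlock, rowTail, encTokens, List.flatMap_assoc, List.flatMap_append,
      List.flatMap_map, List.ofFn_eq_map]

theorem separated_tokens : Separated A.tokens := by
  intro t ht
  simp only [tokens, symTokens, stateBlock, rowBlock, rowTail, List.mem_append, List.mem_flatMap,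
    List.mem_cons, List.mem_map, List.not_mem_nil, or_false] at ht
  rcases ht with (⟨f, -, rfl | rfl⟩ | ⟨q, -, rfl | rfl⟩) | ⟨f, -, v, -, rfl | ⟨q, -, rfl⟩ | rfl⟩
  · rfl
  · rfl
  · rfl
  · dsimp only; split <;> rfl
  · rfl
  · rfl
  · rfl

theorem mem_tuples {n k : ℕ} (v : Fin k → Fin n) : v ∈ tuples n k := by
  simp only [tuples, List.mem_map]
  exact ⟨finFunctionFinEquiv v, List.mem_finRange _, by simp⟩

theorem exists_suffix_rowBlock (f : Fin A.numSyms) (v : Fin (A.arity f) → Fin A.numStates) :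
    ∃ R, A.rowBlock f v ++ R <:+ A.tokens := by
  obtain ⟨R₁, h₁⟩ := exists_suffix_flatMap (A.rowBlock f) (mem_tuples v)
  obtain ⟨R₂, h₂⟩ := exists_suffix_flatMap (fun f =>
      (tuples A.numStates (A.arity f)).flatMap (A.rowBlock f)) (List.mem_finRange f)
  obtain ⟨P, hP⟩ := h₁
  refine ⟨R₁ ++ R₂, List.IsSuffix.trans ⟨P, ?_⟩ (h₂.trans (List.suffix_append _ _))⟩
  simp [← hP]

theorem exists_suffix_stateBlock (q : Fin A.numStates) :
    ∃ R, A.stateBlock q ++ R <:+ A.tokens := by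
  obtain ⟨R, P, h⟩ := exists_suffix_flatMap A.stateBlock (List.mem_finRange q)
  exact ⟨R ++ (List.finRange A.numSyms).flatMap fun f =>
      (tuples A.numStates (A.arity f)).flatMap (A.rowBlock f), A.symTokens ++ P, by
    simp [tokens, ← h]⟩

theorem tokens_eq_flatMap : A.tokens =
    ((List.finRange A.numSyms).map (fun f => [(Letter.sym, f.val), (.sep, A.arity f)]) ++
      (List.finRange A.numStates).map A.stateBlock ++
      (List.finRange A.numSyms).flatMap fun f =>
        (tuples A.numStates (A.arity f)).map (A.rowBlock f)).flatMap id := by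
  simp [tokens, symTokens, List.flatMap_append, List.flatMap_map, List.flatMap_assoc]

theorem exists_rowBlock {n : ℕ} {S : List (Letter × ℕ)} (h : (.trans, n) :: S <:+ A.tokens) :
    ∃ f v R, n = f.val ∧ S = rowTail (fun i => (v i).val) (A.aut.δ f v) ++ R := by
  rw [tokens_eq_flatMap] at h
  obtain ⟨b, hb, P, P', R, h₁, rfl⟩ := exists_of_suffix_flatMap h
  simp only [id] at h₁
  subst h₁
  simp only [List.mem_append, List.mem_map, List.mem_flatMap] at hb
  rcases hb with (⟨f, -, hb⟩ | ⟨q, -, hb⟩) | ⟨f, -, v, -, hb⟩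
  · have : (Letter.trans, n) ∈ [(Letter.sym, f.val), (.sep, A.arity f)] := by rw [hb]; simp
    simp at this
  · have : (Letter.trans, n) ∈ A.stateBlock q := by rw [hb]; simp
    simp [stateBlock] at this
    split at this <;> simp at this
  · refine ⟨f, v, R, ?_⟩
    cases P with
    | nil =>
      rw [rowBlock, List.nil_append, List.cons.injEq] at hb
      simp only [Prod.mk.injEq, true_and] at hb
      exact ⟨hb.1.symm, by rw [hb.2]⟩
    | cons t P =>
      rw [rowBlock, List.cons_append, List.cons.injEq] at hb
      have : (Letter.trans, n) ∈ rowTail (fun i => (v i).val) (A.aut.δ f v) := by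
        rw [hb.2]; simp
      simp [rowTail] at this

theorem exists_stateBlock {n : ℕ} {S : List (Letter × ℕ)} (h : (.state, n) :: S <:+ A.tokens) :
    ∃ (q : Fin A.numStates) (R : List (Letter × ℕ)), n = q.val ∧
      S = (if q ∈ A.aut.acc then .accept else .reject, 0) :: R := by
  rw [tokens_eq_flatMap] at h
  obtain ⟨b, hb, P, P', R, h₁, rfl⟩ := exists_of_suffix_flatMap h
  simp only [id] at h₁
  subst h₁
  simp only [List.mem_append, List.mem_map, List.mem_flatMap] at hb
  rcases hb with (⟨f, -, hb⟩ | ⟨q, -, hb⟩) | ⟨f, -, v, -, hb⟩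
  · have : (Letter.state, n) ∈ [(Letter.sym, f.val), (.sep, A.arity f)] := by rw [hb]; simp
    simp at this
  · refine ⟨q, R, ?_⟩
    cases P with
    | nil =>
      rw [stateBlock, List.nil_append, List.cons.injEq] at hb
      simp only [Prod.mk.injEq, true_and] at hb
      exact ⟨hb.1.symm, by rw [← hb.2]; rfl⟩
    | cons t P =>
      rw [stateBlock, List.cons_append, List.cons.injEq] at hb
      have : (Letter.state, n) ∈ [((if q ∈ A.aut.acc then .accept else .reject : Letter), 0)] := by
        rw [hb.2]; simp
      simp at this
      split at this <;> simp at this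
  · have : (Letter.state, n) ∈ A.rowBlock f v := by rw [hb]; simp
    simp [rowBlock, rowTail] at this

theorem encode_ne_nil : A.encode ≠ [] := by
  obtain ⟨c, -⟩ := A.exists_const
  rw [encode_eq]
  have : A.tokens ≠ [] := by
    intro h
    have hc : (Letter.sym, c.val) ∈ A.tokens := by
      simp [tokens, symTokens]
    simp [h] at hc
  obtain ⟨t, T, h⟩ := List.exists_cons_of_ne_nil this
  simp [h, encTokens_cons]

end DFTAInput

/-! ### The defining formulas -/

/-- The relations on the positions of the word of an automaton that are defined inductively. -/
inductive Sym : Type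
  | eq | next | walk | reach | tail | pair | link | dist | merge
  deriving DecidableEq

instance : Fintype Sym :=
  ⟨{.eq, .next, .walk, .reach, .tail, .pair, .link, .dist, .merge}, fun x => by cases x <;> decide⟩

/-- The arities of the relations. -/
def Sym.arity : Sym → ℕ
  | reach => 1
  | eq | next | walk | dist | merge => 2
  | tail | link => 4
  | pair => 6

/-- Formulas with eight variables. -/
abbrev Formula : Type := Fml (Fin 8) Sym

namespace Formula

/-- The letter at position `x` is `a`. -/
def is (a : Letter) (x : Fin 8) : Formula := .letter (fun b => decide (b = a)) x

/-- There is a position after `x`, and if `y` is the first one, then `φ` holds; the variable `z` is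
used as a bound variable. -/
def exSucc (x y z : Fin 8) (φ : Formula) : Formula :=
  .ex y (.and (.and (.not (.le y x)) (.not (.ex z (.and (.not (.le z x)) (.not (.le y z)))))) φ)

/-- The letter at position `x` is a binary digit. -/
def bit (x : Fin 8) : Formula := .letter isBit x

/-- The positions `0` and `1` are followed by the same number. -/
def eqBody : Formula :=
  .or (exSucc 0 2 4 (exSucc 1 3 4 (.and (.or (.and (is (.bit true) 2) (is (.bit true) 3))
      (.and (is (.bit false) 2) (is (.bit false) 3))) (.rel .eq [2, 3]))))
    (.and (.not (exSucc 0 2 4 (bit 2))) (.not (exSucc 1 2 4 (bit 2))))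

/-- The position `1` is the first one after `0` that carries no digit. -/
def nextBody : Formula :=
  .and (.and (.not (.le 1 0)) (.letter (fun a => !isBit a) 1))
    (.not (.ex 2 (.and (.and (.not (.le 2 0)) (.not (.le 1 2))) (.not (bit 2)))))

/-- From `0` on, in a row of the transition table, all arguments are reachable states, and the
result is the number after `1`. -/
def walkBody : Formula :=
  .or (.and (is .to 0) (.rel .eq [0, 1]))
    (.and (.and (is .sep 0) (.ex 2 (.ex 3 (.and (.and (is .trans 2) (.rel .next [2, 3]))
        (.rel .walk [3, 0])))))
      (.ex 2 (.and (.rel .next [0, 2]) (.rel .walk [2, 1]))))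

/-- The number after `0` is a reachable state. -/
def reachBody : Formula :=
  .ex 1 (.ex 2 (.and (.and (is .trans 1) (.rel .next [1, 2])) (.rel .walk [2, 0])))

/-- From `0` and `1` on, in two rows of the transition table, the arguments are the same reachable
states, and the results are the numbers after `2` and `3`. -/
def tailBody : Formula :=
  .or (.and (.and (is .to 0) (is .to 1)) (.and (.rel .eq [0, 2]) (.rel .eq [1, 3])))
    (.and (.and (.and (is .sep 0) (is .sep 1)) (.and (.rel .eq [0, 1]) (.rel .reach [0])))
      (.ex 4 (.ex 5 (.and (.and (.rel .next [0, 4]) (.rel .next [1, 5]))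
        (.rel .tail [4, 5, 2, 3])))))

/-- From `0` and `1` on, in two rows of the transition table, the arguments are the same reachable
states but for one, at which they are the numbers after `2` and `3`, and the results are the numbers
after `4` and `5`. -/
def pairBody : Formula :=
  .and (.and (is .sep 0) (is .sep 1))
    (.ex 6 (.ex 7 (.and (.and (.rel .next [0, 6]) (.rel .next [1, 7]))
      (.or (.and (.and (.rel .eq [0, 1]) (.rel .reach [0])) (.rel .pair [6, 7, 2, 3, 4, 5]))
        (.and (.and (.rel .eq [0, 2]) (.rel .eq [1, 3])) (.rel .tail [6, 7, 4, 5]))))))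

/-- There is a link from the states after `0` and `1` to those after `2` and `3`. -/
def linkBody : Formula :=
  .ex 4 (.ex 5 (.and (.and (.and (is .trans 4) (is .trans 5)) (.rel .eq [4, 5]))
    (.ex 6 (.ex 7 (.and (.and (.rel .next [4, 6]) (.rel .next [5, 7]))
      (.rel .pair [6, 7, 0, 1, 2, 3]))))))

/-- The number after `x` is a state that is followed by the letter `a`, which tells whether it is
accepting. -/
def status (a : Letter) (x : Fin 8) : Formula :=
  .ex 4 (.and (.and (is .state 4) (.rel .eq [4, x])) (.ex 5 (.and (.rel .next [4, 5]) (is a 5))))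

/-- A context distinguishes the states after `0` and `1`. -/
def distBody : Formula :=
  .or (.or (.and (status .accept 0) (status .reject 1)) (.and (status .reject 0) (status .accept 1)))
    (.ex 2 (.ex 3 (.and (.rel .link [0, 1, 2, 3]) (.rel .dist [2, 3]))))

/-- The number after `x` is a state. -/
def isState (x : Fin 8) : Formula := .ex 4 (.and (is .state 4) (.rel .eq [4, x]))

/-- A context maps the states after `0` and `1` to equivalent states. -/
def mergeBody : Formula :=
  .or (.and (.and (isState 0) (isState 1)) (.not (.rel .dist [0, 1])))
    (.ex 2 (.ex 3 (.and (.rel .link [0, 1, 2, 3]) (.rel .merge [2, 3]))))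

/-- All pairs of reachable states can be merged. -/
def allMerge : Formula :=
  .not (.ex 0 (.ex 1 (.and (.and (.rel .reach [0]) (.rel .reach [1])) (.not (.rel .merge [0, 1])))))

/-- The list of all definitions. -/
def defs : List (IndDef (Fin 8) Sym) :=
  [⟨.eq, [0, 1], eqBody⟩, ⟨.next, [0, 1], nextBody⟩, ⟨.walk, [0, 1], walkBody⟩,
    ⟨.reach, [0], reachBody⟩, ⟨.tail, [0, 1, 2, 3], tailBody⟩,
    ⟨.pair, [0, 1, 2, 3, 4, 5], pairBody⟩, ⟨.link, [0, 1, 2, 3], linkBody⟩,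
    ⟨.dist, [0, 1], distBody⟩, ⟨.merge, [0, 1], mergeBody⟩]

theorem wf_defs : ∀ d ∈ defs, d.WF Sym.arity := by decide

theorem wf_allMerge : allMerge.WF Sym.arity [] := by decide

theorem holds_is {w : List Letter} {R : Sym → List ℕ → Prop} {a : Letter} {x : Fin 8}
    {ρ : Fin 8 → ℕ} : (is a x).Holds w R ρ ↔ w[ρ x]? = some a := by
  simp [is, Fml.Holds]

theorem holds_bit {w : List Letter} {R : Sym → List ℕ → Prop} {x : Fin 8}
    {ρ : Fin 8 → ℕ} : (bit x).Holds w R ρ ↔ ∃ a, w[ρ x]? = some a ∧ isBit a = true := Iff.rfl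

theorem holds_exSucc {w : List Letter} {R : Sym → List ℕ → Prop} {x y z : Fin 8} {φ : Formula}
    {ρ : Fin 8 → ℕ} (hxy : x ≠ y) (hxz : x ≠ z) (hyz : y ≠ z) : (exSucc x y z φ).Holds w R ρ ↔
      ρ x + 1 < w.length ∧ φ.Holds w R (update ρ y (ρ x + 1)) := by
  simp only [exSucc, Fml.Holds, update_self, update_of_ne hxy, update_of_ne hxz, update_of_ne hyz]
  constructor
  · rintro ⟨d, hd, ⟨h₁, h₂⟩, h⟩
    obtain rfl : d = ρ x + 1 := by
      by_contra hne
      exact h₂ ⟨ρ x + 1, by omega, by omega, by omega⟩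
    exact ⟨hd, h⟩
  · rintro ⟨hd, h⟩
    refine ⟨_, hd, ⟨by omega, ?_⟩, h⟩
    rintro ⟨d, -, h₁, h₂⟩
    omega

end Formula

section Values

variable {n : ℕ} {P : List ℕ → Prop}

theorem forall_tups_nil : (∀ l ∈ tups n ([] : List (Fin 8)).length, P l) ↔ P [] := by
  simp [tups]

theorem forall_tups_cons {x : Fin 8} {xs : List (Fin 8)} :
    (∀ l ∈ tups n (x :: xs).length, P l) ↔ ∀ d < n, ∀ l ∈ tups n xs.length, P (d :: l) := by
  simp only [mem_tups]
  constructor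
  · intro h d hd l hl
    exact h (d :: l) ⟨by simp [hl.1], by simpa [hd] using hl.2⟩
  · rintro h l ⟨h₁, h₂⟩
    cases l with
    | nil => simp at h₁
    | cons d l =>
      simp only [List.mem_cons, forall_eq_or_imp] at h₂
      exact h d h₂.1 l ⟨by simpa using h₁, h₂.2⟩

theorem IndDef.value_eq {w : List Letter} {R : Sym → List ℕ → Prop} {d : IndDef (Fin 8) Sym}
    (T : List ℕ → Prop) (hsub : ∀ l, T l → l ∈ tups w.length d.vars.length)
    (hT : ∀ X : List ℕ → Prop, (∀ l, X l → T l) → ∀ l ∈ tups w.length d.vars.length,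
      d.body.Holds w (update R d.m X) (setEnv (fun _ => 0) d.vars l) → T l)
    (hmin : ∀ X : List ℕ → Prop, (∀ l ∈ tups w.length d.vars.length,
      d.body.Holds w (update R d.m X) (setEnv (fun _ => 0) d.vars l) → X l) →
      ∀ l ∈ tups w.length d.vars.length, T l → X l) : d.value w R = T := by
  funext l
  apply propext
  by_cases hl : l ∈ tups w.length d.vars.length
  · exact d.value_iff w R T hT hmin hl
  · exact ⟨fun h => absurd (d.mem_tups_of_stages w R h) hl, fun h => absurd (hsub l h) hl⟩

/-- The value of an explicit definition. -/
theorem IndDef.value_eq_of_iff {w : List Letter} {R : Sym → List ℕ → Prop}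
    {d : IndDef (Fin 8) Sym} (T : List ℕ → Prop)
    (hsub : ∀ l, T l → l ∈ tups w.length d.vars.length)
    (h : ∀ X : List ℕ → Prop, ∀ l ∈ tups w.length d.vars.length,
      d.body.Holds w (update R d.m X) (setEnv (fun _ => 0) d.vars l) ↔ T l) : d.value w R = T :=
  IndDef.value_eq T hsub (fun X _ l hl => (h X l hl).1) fun X hX l hl hT => hX l hl ((h X l hl).2 hT)

end Values

open Formula

/-! ### The defined relations -/

section Numbers

variable {w : List Letter} {d e : ℕ}

theorem digits_of_isBit {a : Letter} (h : w[d + 1]? = some a) (ha : isBit a = true) :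
    digits w d = a :: digits w (d + 1) := by
  rw [digits_eq, if_pos ⟨a, h, ha⟩]
  simp [h]

theorem digits_eq_nil_iff :
    digits w d = [] ↔ ¬ ∃ a, w[d + 1]? = some a ∧ isBit a = true := by
  rw [digits_eq]
  split <;> simp [*]

/-- The relation of positions followed by the same number. -/
def relEq (w : List Letter) : List ℕ → Prop
  | [d, e] => d < w.length ∧ e < w.length ∧ digits w d = digits w e
  | _ => False

theorem value_eqBody (w : List Letter) (R : Sym → List ℕ → Prop) :
    IndDef.value w R ⟨.eq, [0, 1], eqBody⟩ = relEq w := by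
  have hnil : ∀ d, (d + 1 < w.length ∧ ∃ a, w[d + 1]? = some a ∧ isBit a = true) ↔
      digits w d ≠ [] := by
    intro d
    rw [Ne, digits_eq_nil_iff, not_not]
    exact ⟨fun h => h.2, fun ⟨a, h⟩ => ⟨(List.getElem?_eq_some_iff.1 h.1).1, a, h⟩⟩
  refine IndDef.value_eq _ ?_ ?_ ?_
  · intro l hl
    match l, hl with
    | [d, e], hl => simpa [mem_tups] using ⟨hl.1, hl.2.1⟩
  · intro X hX
    simp only [forall_tups_cons, forall_tups_nil]
    intro d hd e he
    simp +decide only [eqBody, Fml.holds_or, Fml.Holds, setEnv, holds_is, holds_bit, update_apply,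
      List.map, if_true, if_false, holds_exSucc, hnil]
    rintro (⟨-, -, h, h'⟩ | ⟨h, h'⟩)
    · refine ⟨hd, he, ?_⟩
      have := (hX _ h').2.2
      rcases h with h | h
      all_goals rw [digits_of_isBit h.1 rfl, digits_of_isBit h.2 rfl, this]
    · exact ⟨hd, he, by rw [not_not.1 h, not_not.1 h']⟩
  · intro X
    simp +decide only [forall_tups_cons, forall_tups_nil, eqBody, Fml.holds_or, Fml.Holds, setEnv,
      holds_is, holds_bit, update_apply,
      List.map, if_true, if_false, holds_exSucc, hnil]
    intro hX d hd e he h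
    obtain ⟨-, -, h⟩ := h
    generalize hu : digits w d = u at h
    induction u generalizing d e with
    | nil => exact hX d hd e he (.inr (by simp [hu, ← h]))
    | cons a u ih =>
      have hd' : digits w d ≠ [] := by simp [hu]
      have he' : digits w e ≠ [] := by simp [← h]
      obtain ⟨hd₁, a₁, h₁, hb₁⟩ := (hnil d).2 hd'
      obtain ⟨he₁, a₂, h₂, hb₂⟩ := (hnil e).2 he'
      rw [digits_of_isBit h₁ hb₁, List.cons.injEq] at hu
      rw [digits_of_isBit h₂ hb₂, List.cons.injEq] at h
      obtain ⟨rfl, hu⟩ := hu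
      obtain ⟨rfl, h⟩ := h
      refine hX d hd e he (.inl ⟨hd₁, he₁, ?_, ih _ hd₁ _ he₁ hu h⟩)
      match a₁, hb₁ with
      | .bit true, _ => exact .inl ⟨h₁, h₂⟩
      | .bit false, _ => exact .inr ⟨h₁, h₂⟩

/-- The relation `IsNext` on the positions. -/
def relNext (w : List Letter) : List ℕ → Prop
  | [d, e] => d < w.length ∧ e < w.length ∧ IsNext w d e
  | _ => False

theorem value_nextBody (w : List Letter) (R : Sym → List ℕ → Prop) :
    IndDef.value w R ⟨.next, [0, 1], nextBody⟩ = relNext w := by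
  refine IndDef.value_eq_of_iff _ ?_ fun X => ?_
  · intro l hl
    match l, hl with
    | [d, e], hl => simpa [mem_tups] using ⟨hl.1, hl.2.1⟩
  · simp only [forall_tups_cons, forall_tups_nil]
    intro d hd e he
    simp only [nextBody, Fml.Holds, setEnv, holds_bit, update_apply, Fin.reduceEq, if_true,
      if_false, relNext, IsNext, hd, he, true_and, not_le, Bool.not_eq_true', and_assoc]
    refine and_congr_right fun _ => and_congr_right fun _ => ?_
    simp only [not_exists, not_and]
    simp only [← not_and, ← not_exists, not_not]
    exact ⟨fun h z h₁ h₂ => h z (h₂.trans he) h₁ h₂, fun h z _ h₁ h₂ => h z h₁ h₂⟩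

end Numbers

/-! ### Walks along the rows of the transition table -/

namespace DFTAInput

variable (A : DFTAInput)

/-- The word of an automaton. -/
abbrev word : List Letter := encTokens A.tokens

variable {A} {d e n : ℕ} {a : Letter} {S : List (Letter × ℕ)}

theorem exists_at_word (h : A.word[d]? = some a) (ha : isBit a = false) :
    ∃ n S, At A.tokens d ((a, n) :: S) ∧ digits A.word d = binary n := by
  obtain ⟨n, S, h⟩ := exists_at_of_getElem? h ha
  exact ⟨n, S, h, h.digits_eq A.separated_tokens⟩

theorem relNext_iff (h : At A.tokens d ((a, n) :: S)) :
    relNext A.word [d, e] ↔ At A.tokens e S := by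
  simp only [relNext]
  rw [h.isNext_iff A.separated_tokens]
  exact ⟨fun h => h.2.2, fun he => ⟨h.1, he.1, he⟩⟩

variable (A) in
/-- The number of a reachable state. -/
def ReachNum (n : ℕ) : Prop := ∃ q : Fin A.numStates, q.val = n ∧ A.aut.Reachable q

/-- The list of tokens begins with numbers that satisfy `G`, followed by a result that is written
`u`. -/
def PWalk (G : ℕ → Prop) : List (Letter × ℕ) → List Letter → Prop
  | [], _ => False
  | (a, n) :: S, u => a = .to ∧ binary n = u ∨ a = .sep ∧ G n ∧ PWalk G S u

theorem PWalk.mono {G G' : ℕ → Prop} (hG : ∀ n, G n → G' n) {u : List Letter} (h : PWalk G S u) :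
    PWalk G' S u := by
  induction S with
  | nil => exact h
  | cons t S ih => exact h.imp id fun h => ⟨h.1, hG _ h.2.1, ih h.2.2⟩

theorem rowTail_zero (v : Fin 0 → ℕ) (r : ℕ) : rowTail v r = [(.to, r)] := rfl

theorem rowTail_succ {k : ℕ} (v : Fin (k + 1) → ℕ) (r : ℕ) :
    rowTail v r = (.sep, v 0) :: rowTail (fun i => v i.succ) r := by
  simp [rowTail, List.ofFn_succ]

theorem pwalk_rowTail {G : ℕ → Prop} {k : ℕ} {v : Fin k → ℕ} {r : ℕ} {R : List (Letter × ℕ)}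
    {u : List Letter} : PWalk G (rowTail v r ++ R) u ↔ (∀ i, G (v i)) ∧ binary r = u := by
  induction k with
  | zero => simp [rowTail_zero, PWalk]
  | succ k ih => simp [rowTail_succ, PWalk, ih, Fin.forall_fin_succ, and_assoc]

theorem exists_of_forall_reachNum {ι : Type} {v : ι → Fin A.numStates}
    (h : ∀ i, A.ReachNum (v i)) (i : ι) : A.aut.Reachable (v i) := by
  obtain ⟨q, hq, hq'⟩ := h i
  rwa [Fin.ext hq] at hq'

theorem reachNum_val {q : Fin A.numStates} : A.ReachNum q ↔ A.aut.Reachable q :=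
  ⟨fun h => exists_of_forall_reachNum (v := fun _ : Unit => q) (fun _ => h) (), fun h => ⟨q, rfl, h⟩⟩

variable (A) in
/-- From the first position on, there is a walk over reachable states to the number after the second
position. -/
def relWalk : List ℕ → Prop
  | [d, e] => d < A.word.length ∧ e < A.word.length ∧
      ∃ S, At A.tokens d S ∧ PWalk A.ReachNum S (digits A.word e)
  | _ => False

theorem exists_reachable_iff {m : ℕ} (hm : m < A.word.length) :
    (∃ d < A.word.length, ∃ e < A.word.length, (A.word[d]? = some .trans ∧ relNext A.word [d, e]) ∧
      A.relWalk [e, m]) ↔ ∃ q, A.aut.Reachable q ∧ digits A.word m = binary q := by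
  constructor
  · rintro ⟨d, -, e, -, ⟨hd, hde⟩, h⟩
    obtain ⟨n, S, hS, -⟩ := exists_at_word hd rfl
    obtain ⟨f, v, R, -, rfl⟩ := exists_rowBlock A hS.2.2
    rw [relNext_iff hS] at hde
    obtain ⟨-, -, S', hS', h⟩ := h
    obtain rfl := hS'.eq hde
    rw [pwalk_rowTail] at h
    exact ⟨_, .δ fun i => reachNum_val.1 (h.1 i), h.2.symm⟩
  · rintro ⟨_, ⟨t, rfl⟩, h⟩
    cases t with
    | var x => exact x.elim
    | app f ts =>
      obtain ⟨R, hR⟩ := A.exists_suffix_rowBlock f fun i => A.aut.eval (ts i)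
      obtain ⟨d, hd⟩ := exists_at hR (by simp [rowBlock])
      rw [rowBlock, List.cons_append] at hd
      obtain ⟨e, he⟩ := hd.exists_next (by simp [rowTail])
      exact ⟨d, hd.1, e, he.1, ⟨hd.getElem?, (relNext_iff hd).2 he⟩, he.1, hm, _, he,
        pwalk_rowTail.2 ⟨fun i => ⟨_, rfl, _, rfl⟩, h.symm⟩⟩

theorem value_walkBody {R : Sym → List ℕ → Prop} (hEq : R .eq = relEq A.word)
    (hNext : R .next = relNext A.word) :
    IndDef.value A.word R ⟨.walk, [0, 1], walkBody⟩ = A.relWalk := by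
  have key : ∀ (X : List ℕ → Prop) (d e : ℕ), walkBody.Holds A.word (update R Sym.walk X)
      (setEnv (fun _ => 0) [0, 1] [d, e]) ↔ 
      (A.word[d]? = some .to ∧ relEq A.word [d, e]) ∨
        ((A.word[d]? = some .sep ∧ ∃ t < A.word.length, ∃ t' < A.word.length,
          (A.word[t]? = some .trans ∧ relNext A.word [t, t']) ∧ X [t', d]) ∧
        ∃ d' < A.word.length, relNext A.word [d, d'] ∧ X [d', e]) := by
    intro X d e
    simp only [walkBody, Fml.holds_or, Fml.Holds, setEnv, holds_is, update_apply, List.map,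
      Fin.reduceEq, if_true, if_false, reduceCtorEq, hEq, hNext]
  refine IndDef.value_eq _ ?_ ?_ ?_
  · intro l hl
    match l, hl with
    | [d, e], hl => simpa [mem_tups] using ⟨hl.1, hl.2.1⟩
  · intro X hX
    simp only [forall_tups_cons, forall_tups_nil]
    intro d hd e he
    rw [key]
    rintro (⟨h, h'⟩ | ⟨⟨h, t, _, t', _, ⟨ht, htt'⟩, h₁⟩, d', -, hdd', h₂⟩)
    · obtain ⟨n, S, hS, hn⟩ := exists_at_word h rfl
      exact ⟨hd, he, _, hS, .inl ⟨rfl, hn ▸ h'.2.2⟩⟩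
    · obtain ⟨n, S, hS, hn⟩ := exists_at_word h rfl
      rw [relNext_iff hS] at hdd'
      obtain ⟨-, -, S', hS', hw⟩ := hX _ h₂
      obtain rfl := hS'.eq hdd'
      obtain ⟨q, hq, e⟩ :=
        (exists_reachable_iff hd).1 ⟨t, ‹_›, t', ‹_›, ⟨ht, htt'⟩, hX _ h₁⟩
      rw [hn, binary_inj] at e
      exact ⟨hd, he, _, hS, .inr ⟨rfl, ⟨q, e.symm, hq⟩, hw⟩⟩
  · intro X
    simp only [forall_tups_cons, forall_tups_nil, key]
    intro hX
    -- `G n` says that the formula recognizes the positions followed by `n` as those of reachable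
    -- states, when the relation `walk` is `X`.
    let G : ℕ → Prop := fun n => ∀ d < A.word.length, digits A.word d = binary n →
      ∃ t < A.word.length, ∃ t' < A.word.length,
        (A.word[t]? = some .trans ∧ relNext A.word [t, t']) ∧ X [t', d]
    have walk : ∀ S d e, At A.tokens d S → e < A.word.length → PWalk G S (digits A.word e) →
        X [d, e] := by
      intro S
      induction S with
      | nil => exact fun _ _ _ _ h => h.elim
      | cons t S ih =>
        obtain ⟨a, n⟩ := t
        intro d e hd he h
        have hn := hd.digits_eq A.separated_tokens
        refine hX d hd.1 e he ?_
        rcases h with ⟨rfl, h⟩ | ⟨rfl, hG, h⟩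
        · exact .inl ⟨hd.getElem?, hd.1, he, hn.trans h⟩
        · obtain ⟨d', hd'⟩ := hd.exists_next (by rintro rfl; exact h)
          exact .inr ⟨⟨hd.getElem?, hG d hd.1 hn⟩, d', hd'.1, (relNext_iff hd).2 hd',
            ih _ _ hd' he h⟩
    have reach : ∀ t, G (A.aut.eval t) := by
      intro t
      induction t with
      | var x => exact x.elim
      | app f ts ih =>
        intro d hd hdn
        obtain ⟨R, hR⟩ := A.exists_suffix_rowBlock f fun i => A.aut.eval (ts i)
        obtain ⟨t, ht⟩ := exists_at hR (by simp [rowBlock])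
        rw [rowBlock, List.cons_append] at ht
        obtain ⟨t', ht'⟩ := ht.exists_next (by simp [rowTail])
        exact ⟨t, ht.1, t', ht'.1, ⟨ht.getElem?, (relNext_iff ht).2 ht'⟩,
          walk _ _ _ ht' hd (pwalk_rowTail.2 ⟨ih, hdn.symm⟩)⟩
    intro d hd e he h
    obtain ⟨-, -, S, hS, h⟩ := h
    refine walk S d e hS he (h.mono ?_)
    rintro _ ⟨_, rfl, t, rfl⟩
    exact reach t

variable (A) in
/-- The relation of positions followed by the number of a reachable state. -/
def relReach : List ℕ → Prop
  | [d] => d < A.word.length ∧ ∃ q, A.aut.Reachable q ∧ digits A.word d = binary q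
  | _ => False

theorem value_reachBody {R : Sym → List ℕ → Prop} (hNext : R .next = relNext A.word)
    (hWalk : R .walk = A.relWalk) :
    IndDef.value A.word R ⟨.reach, [0], reachBody⟩ = A.relReach := by
  refine IndDef.value_eq_of_iff _ ?_ fun X => ?_
  · intro l hl
    match l, hl with
    | [d], hl => simpa [mem_tups] using hl.1
  · simp only [forall_tups_cons, forall_tups_nil]
    intro d hd
    simp only [reachBody, Fml.Holds, setEnv, holds_is, update_apply, List.map,
      Fin.reduceEq, if_true, if_false, reduceCtorEq, hNext, hWalk, relReach, hd, true_and]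
    exact exists_reachable_iff hd

theorem relReach_iff (h : At A.tokens d ((a, n) :: S)) : A.relReach [d] ↔ A.ReachNum n := by
  simp only [relReach, h.1, h.digits_eq A.separated_tokens, binary_inj, true_and, ReachNum]
  exact ⟨fun ⟨q, hq, e⟩ => ⟨q, e.symm, hq⟩, fun ⟨q, e, hq⟩ => ⟨q, hq, e.symm⟩⟩

theorem relEq_iff (h : At A.tokens d ((a, n) :: S)) (he : e < A.word.length) :
    relEq A.word [d, e] ↔ binary n = digits A.word e := by
  simp only [relEq, h.1, he, true_and, h.digits_eq A.separated_tokens]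

theorem relEq_iff_eq {b : Letter} {m : ℕ} {S' : List (Letter × ℕ)}
    (h : At A.tokens d ((a, n) :: S)) (h' : At A.tokens e ((b, m) :: S')) :
    relEq A.word [d, e] ↔ n = m := by
  rw [relEq_iff h h'.1, h'.digits_eq A.separated_tokens, binary_inj]

/-- The lists of tokens begin with the same numbers, which satisfy `G`, followed by results that
are written `u` and `u'`. -/
def PTail (G : ℕ → Prop) :
    List (Letter × ℕ) → List (Letter × ℕ) → List Letter → List Letter → Prop
  | (a, n) :: S, (b, m) :: S', u, u' => (a = .to ∧ b = .to) ∧ binary n = u ∧ binary m = u' ∨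
      (a = .sep ∧ b = .sep) ∧ (n = m ∧ G n) ∧ PTail G S S' u u'
  | _, _, _, _ => False

theorem ptail_rowTail {G : ℕ → Prop} {k : ℕ} {v v' : Fin k → ℕ} {r r' : ℕ}
    {R R' : List (Letter × ℕ)} {u u' : List Letter} :
    PTail G (rowTail v r ++ R) (rowTail v' r' ++ R') u u' ↔
      (∀ i, v i = v' i ∧ G (v i)) ∧ binary r = u ∧ binary r' = u' := by
  induction k with
  | zero => simp [rowTail_zero, PTail]
  | succ k ih => simp [rowTail_succ, PTail, ih, Fin.forall_fin_succ, and_assoc]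

variable (A) in
/-- The relation on the positions that is given by `PTail`. -/
def relTail : List ℕ → Prop
  | [d, e, x, y] => d < A.word.length ∧ e < A.word.length ∧ x < A.word.length ∧
      y < A.word.length ∧ ∃ S S', At A.tokens d S ∧ At A.tokens e S' ∧
        PTail A.ReachNum S S' (digits A.word x) (digits A.word y)
  | _ => False

theorem value_tailBody {R : Sym → List ℕ → Prop} (hEq : R .eq = relEq A.word)
    (hNext : R .next = relNext A.word) (hReach : R .reach = A.relReach) :
    IndDef.value A.word R ⟨.tail, [0, 1, 2, 3], tailBody⟩ = A.relTail := by
  have key : ∀ (X : List ℕ → Prop) (d e x y : ℕ), tailBody.Holds A.word (update R Sym.tail X)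
      (setEnv (fun _ => 0) [0, 1, 2, 3] [d, e, x, y]) ↔
      ((A.word[d]? = some .to ∧ A.word[e]? = some .to) ∧
        relEq A.word [d, x] ∧ relEq A.word [e, y]) ∨
      ((A.word[d]? = some .sep ∧ A.word[e]? = some .sep) ∧
        relEq A.word [d, e] ∧ A.relReach [d]) ∧
        ∃ d' < A.word.length, ∃ e' < A.word.length,
          (relNext A.word [d, d'] ∧ relNext A.word [e, e']) ∧ X [d', e', x, y] := by
    intro X d e x y
    simp only [tailBody, Fml.holds_or, Fml.Holds, setEnv, holds_is, update_apply, List.map,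
      Fin.reduceEq, if_true, if_false, reduceCtorEq, hEq, hNext, hReach]
  refine IndDef.value_eq _ ?_ ?_ ?_
  · intro l hl
    match l, hl with
    | [d, e, x, y], hl => simpa [mem_tups] using ⟨hl.1, hl.2.1, hl.2.2.1, hl.2.2.2.1⟩
  · intro X hX
    simp only [forall_tups_cons, forall_tups_nil]
    intro d hd e he x hx y hy
    rw [key]
    rintro (⟨⟨h₁, h₂⟩, h₃, h₄⟩ | ⟨⟨⟨h₁, h₂⟩, h₃, h₄⟩, d', -, e', -, ⟨h₅, h₆⟩, h⟩)
    all_goals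
      obtain ⟨n, S, hS, -⟩ := exists_at_word h₁ rfl
      obtain ⟨m, S', hS', -⟩ := exists_at_word h₂ rfl
    · rw [relEq_iff hS hx] at h₃
      rw [relEq_iff hS' hy] at h₄
      exact ⟨hd, he, hx, hy, _, _, hS, hS', .inl ⟨⟨rfl, rfl⟩, h₃, h₄⟩⟩
    · rw [relEq_iff_eq hS hS'] at h₃
      rw [relReach_iff hS] at h₄
      rw [relNext_iff hS] at h₅
      rw [relNext_iff hS'] at h₆
      obtain ⟨-, -, -, -, S₁, S₂, hS₁, hS₂, h⟩ := hX _ h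
      obtain rfl := hS₁.eq h₅
      obtain rfl := hS₂.eq h₆
      exact ⟨hd, he, hx, hy, _, _, hS, hS', .inr ⟨⟨rfl, rfl⟩, ⟨h₃, h₄⟩, h⟩⟩
  · intro X
    simp only [forall_tups_cons, forall_tups_nil, key]
    rintro hX d hd e he x hx y hy ⟨-, -, -, -, S, S', hS, hS', h⟩
    induction S generalizing d e S' with
    | nil => exact h.elim
    | cons t S ih =>
      obtain ⟨a, n⟩ := t
      match S', h with
      | (b, m) :: S', h =>
        refine hX d hd e he x hx y hy ?_
        rcases h with ⟨⟨rfl, rfl⟩, h₁, h₂⟩ | ⟨⟨rfl, rfl⟩, ⟨h₁, h₂⟩, h⟩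
        · exact .inl ⟨⟨hS.getElem?, hS'.getElem?⟩, (relEq_iff hS hx).2 h₁, (relEq_iff hS' hy).2 h₂⟩
        · obtain ⟨d', hd'⟩ := hS.exists_next (by rintro rfl; exact h)
          obtain ⟨e', he'⟩ := hS'.exists_next (by rintro rfl; cases S <;> exact h)
          exact .inr ⟨⟨⟨hS.getElem?, hS'.getElem?⟩, (relEq_iff_eq hS hS').2 h₁,
            (relReach_iff hS).2 h₂⟩, d', hd'.1, e', he'.1,
            ⟨(relNext_iff hS).2 hd', (relNext_iff hS').2 he'⟩, ih d' hd'.1 e' he'.1 S' hd' he' h⟩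

/-- The lists of tokens begin with the same numbers, which satisfy `G`, except at one place, where
the numbers are written `p` and `p'`, followed by results that are written `u` and `u'`. -/
def PPair (G : ℕ → Prop) (p p' : List Letter) :
    List (Letter × ℕ) → List (Letter × ℕ) → List Letter → List Letter → Prop
  | (a, n) :: S, (b, m) :: S', u, u' => (a = .sep ∧ b = .sep) ∧
      ((n = m ∧ G n) ∧ PPair G p p' S S' u u' ∨
        (binary n = p ∧ binary m = p') ∧ PTail G S S' u u')
  | _, _, _, _ => False

theorem ppair_rowTail {G : ℕ → Prop} {k : ℕ} {v v' : Fin k → ℕ} {r r' : ℕ}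
    {R R' : List (Letter × ℕ)} {p p' u u' : List Letter} :
    PPair G p p' (rowTail v r ++ R) (rowTail v' r' ++ R') u u' ↔
      ∃ i, (∀ j ≠ i, v j = v' j ∧ G (v j)) ∧ (binary (v i) = p ∧ binary (v' i) = p') ∧
        binary r = u ∧ binary r' = u' := by
  induction k with
  | zero => simp [rowTail_zero, PPair]
  | succ k ih =>
    simp only [rowTail_succ, List.cons_append, PPair, true_and, ih, ptail_rowTail,
      Fin.exists_fin_succ, Fin.forall_fin_succ, ne_eq, not_true_eq_false, false_implies,
      Fin.succ_ne_zero, not_false_eq_true, true_implies, (Fin.succ_ne_zero _).symm, Fin.succ_inj]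
    constructor
    · rintro (⟨h, i, h₁, h₂⟩ | ⟨h, h₁, h₂⟩)
      · exact .inr ⟨i, ⟨h, h₁⟩, h₂⟩
      · exact .inl ⟨h₁, h, h₂⟩
    · rintro (⟨h₁, h, h₂⟩ | ⟨i, ⟨h, h₁⟩, h₂⟩)
      · exact .inr ⟨h, h₁, h₂⟩
      · exact .inl ⟨h, i, h₁, h₂⟩

variable (A) in
/-- The relation on the positions that is given by `PPair`. -/
def relPair : List ℕ → Prop
  | [d, e, p, q, x, y] => d < A.word.length ∧ e < A.word.length ∧ p < A.word.length ∧
      q < A.word.length ∧ x < A.word.length ∧ y < A.word.length ∧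
      ∃ S S', At A.tokens d S ∧ At A.tokens e S' ∧
        PPair A.ReachNum (digits A.word p) (digits A.word q) S S'
          (digits A.word x) (digits A.word y)
  | _ => False

theorem value_pairBody {R : Sym → List ℕ → Prop} (hEq : R .eq = relEq A.word)
    (hNext : R .next = relNext A.word) (hReach : R .reach = A.relReach)
    (hTail : R .tail = A.relTail) :
    IndDef.value A.word R ⟨.pair, [0, 1, 2, 3, 4, 5], pairBody⟩ = A.relPair := by
  have key : ∀ (X : List ℕ → Prop) (d e p q x y : ℕ),
      pairBody.Holds A.word (update R Sym.pair X)
        (setEnv (fun _ => 0) [0, 1, 2, 3, 4, 5] [d, e, p, q, x, y]) ↔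
      (A.word[d]? = some .sep ∧ A.word[e]? = some .sep) ∧
        ∃ d' < A.word.length, ∃ e' < A.word.length,
          (relNext A.word [d, d'] ∧ relNext A.word [e, e']) ∧
          ((relEq A.word [d, e] ∧ A.relReach [d]) ∧ X [d', e', p, q, x, y] ∨
            (relEq A.word [d, p] ∧ relEq A.word [e, q]) ∧ A.relTail [d', e', x, y]) := by
    intro X d e p q x y
    simp only [pairBody, Fml.holds_or, Fml.Holds, setEnv, holds_is, update_apply, List.map,
      Fin.reduceEq, if_true, if_false, reduceCtorEq, hEq, hNext, hReach, hTail]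
  refine IndDef.value_eq _ ?_ ?_ ?_
  · intro l hl
    match l, hl with
    | [d, e, p, q, x, y], hl =>
      simpa [mem_tups] using ⟨hl.1, hl.2.1, hl.2.2.1, hl.2.2.2.1, hl.2.2.2.2.1, hl.2.2.2.2.2.1⟩
  · intro X hX
    simp only [forall_tups_cons, forall_tups_nil]
    intro d hd e he p hp q hq x hx y hy
    rw [key]
    rintro ⟨⟨h₁, h₂⟩, d', -, e', -, ⟨h₃, h₄⟩, h⟩
    obtain ⟨n, S, hS, -⟩ := exists_at_word h₁ rfl
    obtain ⟨m, S', hS', -⟩ := exists_at_word h₂ rfl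
    rw [relNext_iff hS] at h₃
    rw [relNext_iff hS'] at h₄
    refine ⟨hd, he, hp, hq, hx, hy, _, _, hS, hS', ⟨rfl, rfl⟩, ?_⟩
    rcases h with ⟨⟨h₅, h₆⟩, h⟩ | ⟨⟨h₅, h₆⟩, h⟩
    · obtain ⟨-, -, -, -, -, -, S₁, S₂, hS₁, hS₂, h⟩ := hX _ h
      obtain rfl := hS₁.eq h₃
      obtain rfl := hS₂.eq h₄
      exact .inl ⟨⟨(relEq_iff_eq hS hS').1 h₅, (relReach_iff hS).1 h₆⟩, h⟩
    · obtain ⟨-, -, -, -, S₁, S₂, hS₁, hS₂, h⟩ := h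
      obtain rfl := hS₁.eq h₃
      obtain rfl := hS₂.eq h₄
      exact .inr ⟨⟨(relEq_iff hS hp).1 h₅, (relEq_iff hS' hq).1 h₆⟩, h⟩
  · intro X
    simp only [forall_tups_cons, forall_tups_nil, key]
    rintro hX d hd e he p hp q hq x hx y hy ⟨-, -, -, -, -, -, S, S', hS, hS', h⟩
    induction S generalizing d e S' with
    | nil => exact h.elim
    | cons t S ih =>
      obtain ⟨a, n⟩ := t
      match S', h with
      | (b, m) :: S', h =>
        obtain ⟨⟨rfl, rfl⟩, h'⟩ := h
        obtain ⟨d', hd'⟩ := hS.exists_next (by rintro rfl; simp [PPair, PTail] at h')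
        obtain ⟨e', he'⟩ := hS'.exists_next
          (by rintro rfl; cases S <;> simp [PPair, PTail] at h')
        refine hX d hd e he p hp q hq x hx y hy ⟨⟨hS.getElem?, hS'.getElem?⟩, d', hd'.1, e', he'.1,
          ⟨(relNext_iff hS).2 hd', (relNext_iff hS').2 he'⟩, ?_⟩
        rcases h' with ⟨⟨h₁, h₂⟩, h⟩ | ⟨⟨h₁, h₂⟩, h⟩
        · exact .inl ⟨⟨(relEq_iff_eq hS hS').2 h₁, (relReach_iff hS).2 h₂⟩,
            ih d' hd'.1 e' he'.1 S' hd' he' h⟩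
        · exact .inr ⟨⟨(relEq_iff hS hp).2 h₁, (relEq_iff hS' hq).2 h₂⟩, hd'.1, he'.1, hx, hy,
            _, _, hd', he', h⟩

/-! ### Pairs of states and links -/

variable (A) in
/-- The positions `d` and `e` are followed by the numbers of the states of the pair `x`. -/
def IsPair (d e : ℕ) (x : Fin A.numStates × Fin A.numStates) : Prop :=
  (d < A.word.length ∧ e < A.word.length) ∧
    digits A.word d = binary x.1 ∧ digits A.word e = binary x.2

theorem IsPair.eq {x y : Fin A.numStates × Fin A.numStates} (hx : A.IsPair d e x)
    (hy : A.IsPair d e y) : x = y :=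
  Prod.ext (Fin.ext (binary_inj.1 (hx.2.1.symm.trans hy.2.1)))
    (Fin.ext (binary_inj.1 (hx.2.2.symm.trans hy.2.2)))

theorem exists_at_state (q : Fin A.numStates) : ∃ d S,
    At A.tokens d ((.state, q.val) :: (if q ∈ A.aut.acc then .accept else .reject, 0) :: S) := by
  obtain ⟨R, hR⟩ := A.exists_suffix_stateBlock q
  obtain ⟨d, hd⟩ := exists_at hR (by simp [stateBlock])
  exact ⟨d, R, hd⟩

variable (A) in
theorem exists_isPair (x : Fin A.numStates × Fin A.numStates) : ∃ d e, A.IsPair d e x := by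
  obtain ⟨d, S, hd⟩ := exists_at_state x.1
  obtain ⟨e, S', he⟩ := exists_at_state x.2
  exact ⟨d, e, ⟨hd.1, he.1⟩, hd.digits_eq A.separated_tokens, he.digits_eq A.separated_tokens⟩

variable (A) in
/-- The relation `Link` on the positions. -/
def relLink : List ℕ → Prop
  | [p, q, a, b] => ∃ x y, A.IsPair p q x ∧ A.IsPair a b y ∧ A.aut.Link x y
  | _ => False

theorem value_linkBody {R : Sym → List ℕ → Prop} (hEq : R .eq = relEq A.word)
    (hNext : R .next = relNext A.word) (hPair : R .pair = A.relPair) :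
    IndDef.value A.word R ⟨.link, [0, 1, 2, 3], linkBody⟩ = A.relLink := by
  refine IndDef.value_eq_of_iff _ ?_ fun X => ?_
  · intro l hl
    match l, hl with
    | [p, q, a, b], ⟨x, y, h, h', _⟩ => simpa [mem_tups] using ⟨h.1.1, h.1.2, h'.1.1, h'.1.2⟩
  simp only [forall_tups_cons, forall_tups_nil]
  intro p hp q hq a ha b hb
  simp only [linkBody, Fml.Holds, setEnv, holds_is, update_apply, List.map,
    Fin.reduceEq, if_true, if_false, reduceCtorEq, hEq, hNext, hPair]
  constructor
  · rintro ⟨t, -, t', -, ⟨⟨ht, ht'⟩, htt'⟩, s, -, s', -, ⟨hs, hs'⟩, h⟩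
    obtain ⟨n, S, hS, -⟩ := exists_at_word ht rfl
    obtain ⟨n', S', hS', -⟩ := exists_at_word ht' rfl
    rw [relEq_iff_eq hS hS'] at htt'
    rw [relNext_iff hS] at hs
    rw [relNext_iff hS'] at hs'
    obtain ⟨-, -, -, -, -, -, S₁, S₂, hS₁, hS₂, h⟩ := h
    obtain rfl := hS₁.eq hs
    obtain rfl := hS₂.eq hs'
    obtain ⟨f, v, R₁, rfl, rfl⟩ := exists_rowBlock A hS.2.2
    obtain ⟨f', v', R₂, rfl, rfl⟩ := exists_rowBlock A hS'.2.2
    obtain rfl := Fin.ext htt'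
    obtain ⟨i, h₁, ⟨h₂, h₃⟩, h₄, h₅⟩ := ppair_rowTail.1 h
    refine ⟨(v i, v' i), (A.aut.δ f v, A.aut.δ f v'), ⟨⟨hp, hq⟩, h₂.symm, h₃.symm⟩,
      ⟨⟨ha, hb⟩, h₄.symm, h₅.symm⟩, f, v, i, fun j hj => reachNum_val.1 (h₁ j hj).2, ?_⟩
    have e : v' = update v i (v' i) := by
      funext j
      by_cases hj : j = i
      · subst hj; simp
      · simpa [hj] using (Fin.ext (h₁ j hj).1).symm
    simp [← e]
  · rintro ⟨x, _, ⟨-, h₁, h₂⟩, ⟨-, h₃, h₄⟩, f, v, i, hv, rfl⟩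
    obtain ⟨R₁, hR₁⟩ := A.exists_suffix_rowBlock f (update v i x.1)
    obtain ⟨R₂, hR₂⟩ := A.exists_suffix_rowBlock f (update v i x.2)
    obtain ⟨t, ht⟩ := exists_at hR₁ (by simp [rowBlock])
    obtain ⟨t', ht'⟩ := exists_at hR₂ (by simp [rowBlock])
    rw [rowBlock, List.cons_append] at ht ht'
    obtain ⟨s, hs⟩ := ht.exists_next (by simp [rowTail])
    obtain ⟨s', hs'⟩ := ht'.exists_next (by simp [rowTail])
    refine ⟨t, ht.1, t', ht'.1, ⟨⟨ht.getElem?, ht'.getElem?⟩, (relEq_iff_eq ht ht').2 rfl⟩,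
      s, hs.1, s', hs'.1, ⟨(relNext_iff ht).2 hs, (relNext_iff ht').2 hs'⟩,
      hs.1, hs'.1, hp, hq, ha, hb, _, _, hs, hs', ppair_rowTail.2 ⟨i, fun j hj => ?_, ?_⟩⟩
    · simpa [hj] using reachNum_val.2 (hv j hj)
    · simp [h₁, h₂, h₃, h₄]

variable (A) in
/-- The relation of positions followed by the numbers of the states of a pair that satisfies `P`. -/
def relPairs (P : Fin A.numStates × Fin A.numStates → Prop) : List ℕ → Prop
  | [d, e] => ∃ x, A.IsPair d e x ∧ P x
  | _ => False

/-- A definition that closes a set of pairs of states under going back along links. -/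
theorem value_of_links {R : Sym → List ℕ → Prop} {m : Sym} {φ : Formula}
    {P : Fin A.numStates × Fin A.numStates → Prop}
    (h : ∀ (X : List ℕ → Prop), ∀ d < A.word.length, ∀ e < A.word.length,
      φ.Holds A.word (update R m X) (setEnv (fun _ => 0) [0, 1] [d, e]) ↔
        A.relPairs P [d, e] ∨ ∃ a < A.word.length, ∃ b < A.word.length,
          A.relLink [d, e, a, b] ∧ X [a, b]) :
    IndDef.value A.word R ⟨m, [0, 1], φ⟩ =
      A.relPairs fun x => ∃ y, Relation.ReflTransGen A.aut.Link x y ∧ P y := by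
  refine IndDef.value_eq _ ?_ ?_ ?_
  · intro l hl
    match l, hl with
    | [d, e], ⟨x, hx, _⟩ => simpa [mem_tups] using hx.1
  · intro X hX
    simp only [forall_tups_cons, forall_tups_nil]
    intro d hd e he
    rw [h X d hd e he]
    rintro (⟨x, hx, hP⟩ | ⟨a, -, b, -, ⟨x, y, hx, hy, hxy⟩, hab⟩)
    · exact ⟨x, hx, x, .refl, hP⟩
    · obtain ⟨y', hy', z, hz, hP⟩ := hX _ hab
      obtain rfl := hy'.eq hy
      exact ⟨x, hx, z, .head hxy hz, hP⟩
  · intro X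
    simp only [forall_tups_cons, forall_tups_nil]
    rintro hX d hd e he ⟨x, hx, z, hxz, hP⟩
    induction hxz using Relation.ReflTransGen.head_induction_on generalizing d e with
    | refl => exact hX d hd e he ((h X d hd e he).2 (.inl ⟨z, hx, hP⟩))
    | @head x y hxy _ ih =>
      obtain ⟨a, b, hab⟩ := A.exists_isPair y
      exact hX d hd e he ((h X d hd e he).2 (.inr ⟨a, hab.1.1, b, hab.1.2, ⟨x, y, hx, hab, hxy⟩,
        ih a hab.1.1 b hab.1.2 hab⟩))

theorem exists_state_iff (hd : d < A.word.length) :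
    (∃ t < A.word.length, A.word[t]? = some .state ∧ relEq A.word [t, d]) ↔
      ∃ q : Fin A.numStates, digits A.word d = binary q := by
  constructor
  · rintro ⟨t, -, ht, h⟩
    obtain ⟨n, S, hS, -⟩ := exists_at_word ht rfl
    obtain ⟨q, R, rfl, rfl⟩ := exists_stateBlock A hS.2.2
    exact ⟨q, ((relEq_iff hS hd).1 h).symm⟩
  · rintro ⟨q, h⟩
    obtain ⟨t, S, ht⟩ := exists_at_state q
    exact ⟨t, ht.1, ht.getElem?, (relEq_iff ht hd).2 h.symm⟩

theorem exists_status_iff (hd : d < A.word.length) :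
    (∃ t < A.word.length, (A.word[t]? = some .state ∧ relEq A.word [t, d]) ∧
      ∃ s < A.word.length, relNext A.word [t, s] ∧ A.word[s]? = some a) ↔
      ∃ q : Fin A.numStates, digits A.word d = binary q ∧
        (if q ∈ A.aut.acc then Letter.accept else .reject) = a := by
  constructor
  · rintro ⟨t, -, ⟨ht, h⟩, s, -, hts, hs⟩
    obtain ⟨n, S, hS, -⟩ := exists_at_word ht rfl
    obtain ⟨q, R, rfl, rfl⟩ := exists_stateBlock A hS.2.2
    rw [relNext_iff hS] at hts
    exact ⟨q, ((relEq_iff hS hd).1 h).symm, Option.some.inj (hts.getElem?.symm.trans hs)⟩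
  · rintro ⟨q, h, rfl⟩
    obtain ⟨t, S, ht⟩ := exists_at_state q
    obtain ⟨s, hs⟩ := ht.exists_next (by simp)
    exact ⟨t, ht.1, ⟨ht.getElem?, (relEq_iff ht hd).2 h.symm⟩, s, hs.1, (relNext_iff ht).2 hs,
      hs.getElem?⟩

theorem value_distBody {R : Sym → List ℕ → Prop} (hEq : R .eq = relEq A.word)
    (hNext : R .next = relNext A.word) (hLink : R .link = A.relLink) :
    IndDef.value A.word R ⟨.dist, [0, 1], distBody⟩ = A.relPairs A.aut.Distinct := by
  refine value_of_links fun X d hd e he => ?_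
  simp only [distBody, status, Fml.holds_or, Fml.Holds, setEnv, holds_is, update_apply, List.map,
    Fin.reduceEq, if_true, if_false, reduceCtorEq, hEq, hNext, hLink, exists_status_iff hd,
    exists_status_iff he]
  refine or_congr_left ?_
  constructor
  · rintro (⟨⟨p, hp, hp'⟩, q, hq, hq'⟩ | ⟨⟨p, hp, hp'⟩, q, hq, hq'⟩)
    all_goals
      refine ⟨(p, q), ⟨⟨hd, he⟩, hp, hq⟩, ?_⟩
      simp only [ite_eq_left_iff, ite_eq_right_iff, reduceCtorEq, imp_false, not_not] at hp' hq'
      simp [hp', hq']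
  · rintro ⟨⟨p, q⟩, ⟨-, hp, hq⟩, h⟩
    by_cases hp' : p ∈ A.aut.acc
    · exact .inl ⟨⟨p, hp, by simp [hp']⟩, q, hq, by simp_all⟩
    · exact .inr ⟨⟨p, hp, by simp [hp']⟩, q, hq, by simp_all⟩

theorem value_mergeBody {R : Sym → List ℕ → Prop} (hEq : R .eq = relEq A.word)
    (hLink : R .link = A.relLink) (hDist : R .dist = A.relPairs A.aut.Distinct) :
    IndDef.value A.word R ⟨.merge, [0, 1], mergeBody⟩ = A.relPairs A.aut.Mergeable := by
  refine value_of_links fun X d hd e he => ?_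
  simp only [mergeBody, isState, Fml.holds_or, Fml.Holds, setEnv, holds_is, update_apply, List.map,
    Fin.reduceEq, if_true, if_false, reduceCtorEq, hEq, hLink, hDist, exists_state_iff hd,
    exists_state_iff he]
  refine or_congr_left ?_
  constructor
  · rintro ⟨⟨⟨p, hp⟩, q, hq⟩, h⟩
    exact ⟨(p, q), ⟨⟨hd, he⟩, hp, hq⟩, fun h' => h ⟨(p, q), ⟨⟨hd, he⟩, hp, hq⟩, h'⟩⟩
  · rintro ⟨x, hx, h⟩
    refine ⟨⟨⟨_, hx.2.1⟩, _, hx.2.2⟩, ?_⟩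
    rintro ⟨y, hy, h'⟩
    exact h (hx.eq hy ▸ h')

theorem holds_allMerge : allMerge.Holds A.word (valueAll A.word defs fun _ _ => False)
    (fun _ => 0) ↔ ∀ p q, A.aut.Reachable p → A.aut.Reachable q → A.aut.Mergeable (p, q) := by
  have hReach : valueAll A.word defs (fun _ _ => False) .reach = A.relReach ∧
      valueAll A.word defs (fun _ _ => False) .merge = A.relPairs A.aut.Mergeable := by
    simp only [defs, valueAll]
    rw [value_eqBody, value_nextBody, value_walkBody (by simp) (by simp),
      value_reachBody (by simp) (by simp), value_tailBody (by simp) (by simp) (by simp),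
      value_pairBody (by simp) (by simp) (by simp) (by simp),
      value_linkBody (by simp) (by simp) (by simp), value_distBody (by simp) (by simp) (by simp),
      value_mergeBody (by simp) (by simp) (by simp)]
    simp
  simp only [allMerge, Fml.Holds, update_apply, List.map, Fin.reduceEq, if_true, if_false,
    hReach.1, hReach.2]
  constructor
  · intro h p q hp hq
    by_contra hn
    obtain ⟨d, e, hde⟩ := A.exists_isPair (p, q)
    refine h ⟨d, hde.1.1, e, hde.1.2, ⟨⟨hde.1.1, p, hp, hde.2.1⟩, hde.1.2, q, hq, hde.2.2⟩, ?_⟩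
    rintro ⟨x, hx, h'⟩
    exact hn (hde.eq hx ▸ h')
  · rintro h ⟨d, hd, e, he, ⟨⟨-, p, hp, hp'⟩, -, q, hq, hq'⟩, hn⟩
    exact hn ⟨(p, q), ⟨⟨hd, he⟩, hp', hq'⟩, h p q hp hq⟩

end DFTAInput

end TreeAutomata

theorem mainTheorem8 :
    TreeAutomata.PolyTimeDecidable TreeAutomata.DFTAInput.encode
      (fun A : TreeAutomata.DFTAInput =>
        ∃ (l : TreeAutomata.Term A.sig ℕ) (r : TreeAutomata.Tree A.sig),
          l.IsContext ∧
          TreeAutomata.Consistent {(l, TreeAutomata.Term.ofTree r)} A.aut.language) := by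
  open TreeAutomata StackProgram TreeAutomata.Formula in
  refine polyTimeDecidable_of_indDefs 6 _ DFTAInput.encode_ne_nil Sym.arity
    (fun m => by cases m <;> decide) defs wf_defs allMerge wf_allMerge fun A => ?_
  rw [TreeAutomata.DFTAInput.encode_eq, TreeAutomata.DFTAInput.holds_allMerge]
  exact TreeAutomata.DFTA.exists_consistent_rule_iff A.aut
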